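/- Let $\{0,1\}^n$ be the Hamming cube with the Hamming distance $|x-y|$. Fix $0<R<1$ and $\tau>0$, and put $N=\lfloor 2^{Rn}\rfloor$. Let $d_0=d_0(R,\tau,n)$ be the largest integer $k$ between $1$ and $N$ with $\frac{N}{2^n}\sum_{\ell=0}^{k-1}\binom n\ell\le\tau$ (it exists for all large $n$; put $d_0=0$ otherwise). A random code $C\subseteq\{0,1\}^n$ of prescribed cardinality $N$ with parameter $\tau$ is obtained as follows: choose $x_1,\dots,x_N\in\{0,1\}^n$ independently and uniformly at random, erase both $x_a$ and $x_b$ from this list for all $1\le a<b\le N$ with $|x_a-x_b|\le d_0-1$, and let $C$ be the set of the remaining points. For a code $C$ and $i\ge1$ let $G(C,i)$ be the graph with vertex set $C$ in which two codewords are adjacent iff their distance is $i$. For a real function $f$ on the finite set $C$, endowed with the uniform probability measure, let $\|f\|_p=\big(\frac1{|C|}\sum_{x\in C}|f(x)|^p\big)^{1/p}$. **Proposition 1.9.** Let $0<R<1$. There are $\varepsilon_0=\varepsilon_0(R)>0$ and $\tau_0=\tau_0(R)>0$ such that for every $0<\tau\le\tau_0$ there is a constant $K=K(R,\tau)>0$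 for which the following holds with probability tending to $1$ as $n\to\infty$ for the random code $C\subseteq\{0,1\}^n$ of prescribed cardinality $\lfloor 2^{Rn}\rfloor$ with parameter $\tau$. The code $C$ has at least two points, and, if $d$ denotes its minimal distance, then for every integer $i$ with $d\le i\le(1+\varepsilon_0)d$ the vector $\lambda\in\mathbb R^C$ of the eigenvalues, with multiplicity, of the adjacency matrix of $G(C,i)$ satisfies $$\lambda\ne0\qquad\text{and}\qquad\frac{\|\lambda\|_4}{\|\lambda\|_2}\le K.$$ -/

import Mathlib

open MeasureTheory Filter Topology
open scoped BigOperators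

noncomputable section

namespace RandomCode

/-- The Hamming cube `{0,1}^n`; its metric is Mathlib's `hammingDist`. -/
abbrev Cube (n : ℕ) : Type := Fin n → Bool

/-- The minimal distance of a code: the least Hamming distance between two distinct codewords
(with the junk value `0` if there are no two distinct codewords). -/
def minDist {n : ℕ} (C : Finset (Cube n)) : ℕ :=
  sInf {k : ℕ | ∃ x ∈ C, ∃ y ∈ C, x ≠ y ∧ hammingDist x y = k}

/-- The distance-`i` graph `G(C,i)`: its vertices are the codewords, and two (distinct) codewords
are joined iff they are at Hamming distance `i`. -/
def distGraph {n : ℕ} (C : Finset (Cube n)) (i : ℕ) : SimpleGraph C where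
  Adj x y := x ≠ y ∧ hammingDist (x : Cube n) (y : Cube n) = i
  symm := ⟨fun _ _ h => ⟨h.1.symm, (hammingDist_comm _ _).trans h.2⟩⟩
  loopless := ⟨fun _ h => h.1 rfl⟩

instance {n : ℕ} (C : Finset (Cube n)) (i : ℕ) : DecidableRel (distGraph C i).Adj :=
  fun x y => inferInstanceAs (Decidable (x ≠ y ∧ hammingDist (x : Cube n) (y : Cube n) = i))

theorem adjMatrix_isHermitian {V : Type*} (G : SimpleGraph V) [DecidableRel G.Adj] :
    (G.adjMatrix ℝ).IsHermitian := by
  rw [Matrix.IsHermitian, Matrix.conjTranspose_eq_transpose_of_trivial]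
  exact G.isSymm_adjMatrix

/-- The vector `λ ∈ ℝ^C` of the eigenvalues (with multiplicity) of the adjacency matrix of
`G(C,i)`. -/
def eigenvalueVector {n : ℕ} (C : Finset (Cube n)) (i : ℕ) : C → ℝ :=
  (adjMatrix_isHermitian (distGraph C i)).eigenvalues

/-- The `L^p` norm of a function on a finite set endowed with the uniform probability measure. -/
def uniformNorm {ι : Type*} [Fintype ι] (p : ℕ) (f : ι → ℝ) : ℝ :=
  ((∑ x, |f x| ^ p) / (Fintype.card ι : ℝ)) ^ (1 / (p : ℝ))

/-- The prescribed cardinality `N = ⌊2^{Rn}⌋`. -/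
def prescribedCard (R : ℝ) (n : ℕ) : ℕ := ⌊(2 : ℝ) ^ (R * (n : ℝ))⌋₊

open Classical in
/-- The erasure threshold `d₀`: the largest integer `k` between `1` and `N` with
`(N / 2^n) * ∑_{ℓ < k} (n choose ℓ) ≤ τ` (and `0` if there is none). -/
def threshold (R τ : ℝ) (n : ℕ) : ℕ :=
  Nat.findGreatest
    (fun k => (prescribedCard R n : ℝ) / 2 ^ n * ∑ l ∈ Finset.range k, (n.choose l : ℝ) ≤ τ)
    (prescribedCard R n)

/-- The code that remains of the list `x` after both points of every pair of (differently indexed)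
points at distance less than `d₀` are erased. -/
def erase {n N : ℕ} (d₀ : ℕ) (x : Fin N → Cube n) : Finset (Cube n) :=
  (Finset.univ.filter fun a : Fin N => ∀ b, b ≠ a → d₀ ≤ hammingDist (x a) (x b)).image x

/-- The law of `N` independent uniformly distributed points of the cube. -/
def pointsLaw (n N : ℕ) : Measure (Fin N → Cube n) :=
  Measure.pi fun _ => (PMF.uniformOfFintype (Cube n)).toMeasure

/-- The random code of prescribed cardinality `⌊2^{Rn}⌋` with parameter `τ`, as a function of the
list of random points. -/
def code (R τ : ℝ) (n : ℕ) (x : Fin (prescribedCard R n) → Cube n) : Finset (Cube n) :=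
  erase (threshold R τ n) x

end RandomCode

end

/-! Let p be the proportion of the cube at distance exactly i from a fixed point, and A the
adjacency matrix of G(C,i). Power sums of eigenvalues are traces, so it suffices that N · tr A⁴ =
O((tr A²)²). Here tr A² counts ordered edges, about N²p of them. Closed 4-walks are either
degenerate, hence counted by edges and cherries (paths with two edges), about N²p + N³p² up to
constants, or genuine four-cycles. So three things are needed: Np bounded below, concentration of
the edge and cherry counts, and O(N³p²) four-cycles.

Lower bound for Np: by maximality of d₀ the ball of radius d₀ carries more than τ expected points,
and since d₀ stays below βn with β < 1/2, its outer sphere carries a fixed fraction of them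
(`le_mul_sphereDensity_threshold`).

Concentration: distances along the edges of a tree of random points are independent. Thus two
cherries sharing at most one vertex are uncorrelated, and Chebyshev applies
(`expect_cherryCount_sub_sq_le`). An edge lost to erasure extends to a cherry whose other edge is
shorter than d₀; for small τ these are a small fraction of all edges.

Four-cycles: a Chernoff bound that factorizes over coordinates gives density at most ρⁿp³ up to a
polynomial, with ρ < 1 (`expect_square_le_density`, `exists_square_base`). For i ≤ (1+ε₀)d₀, Np
grows at most like (1/α)^(ε₀n), which a small ε₀ makes less than ρ^(-n/2); Markov's inequality then
suffices (`card_not_typicalAt_le`).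

A union bound over at most n+1 distances finishes the proof. The case i = d₀ also shows that a pair
at distance d₀ survives, so the minimal distance is d₀. -/

namespace RandomCode

open Finset Function

set_option linter.unusedSectionVars false

/-! ### Second moments of cherry counts for independent random points -/

section Expectation

variable {ι X : Type*} [Fintype ι] [DecidableEq ι] [Fintype X] [Nonempty X]

theorem expect_resample (a : ι) (f : (ι → X) → ℝ) :
    𝔼 x, f x = 𝔼 x : ι → X, 𝔼 y : X, f (update x a y) := by
  have hX : (Fintype.card X : ℝ) ≠ 0 := by simp
  have key : ∑ x : ι → X, ∑ y : X, f (update x a y) = ∑ x : ι → X, ∑ _y : X, f x := by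
    rw [← Fintype.sum_prod_type', ← Fintype.sum_prod_type']
    -- Exchanging the coordinate `a` with the fresh point is an involution of pairs.
    refine Finset.sum_nbij' (fun z => (update z.1 a z.2, z.1 a))
      (fun z => (update z.1 a z.2, z.1 a)) ?_ ?_ ?_ ?_ ?_ <;> simp
  simp only [Fintype.expect_eq_sum_div_card, ← Finset.sum_div]
  rw [key]
  simp only [sum_const, card_univ, nsmul_eq_mul, ← Finset.mul_sum]
  field_simp

/-- Averaging over the leaf `b` alone gives `p` whatever the position of `a`. This constancy of row
averages is what makes tree-shaped products independent. -/
theorem expect_leaf {u : X → X → ℝ} {p : ℝ} (hu : ∀ z, 𝔼 y, u z y = p) {a b : ι} (hab : a ≠ b)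
    (h : (ι → X) → ℝ) (hh : ∀ x y, h (update x b y) = h x) :
    𝔼 x, u (x a) (x b) * h x = p * 𝔼 x, h x := by
  rw [expect_resample b, Finset.mul_expect]
  refine Finset.expect_congr rfl fun x _ => ?_
  simp only [hh, update_self, update_of_ne hab]
  rw [← Finset.expect_mul, hu]

theorem expect_leaf' {u : X → X → ℝ} {p : ℝ} (hs : ∀ y z, u y z = u z y)
    (hu : ∀ z, 𝔼 y, u z y = p) {a b : ι} (hab : a ≠ b)
    (h : (ι → X) → ℝ) (hh : ∀ x y, h (update x a y) = h x) :
    𝔼 x, u (x a) (x b) * h x = p * 𝔼 x, h x := by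
  rw [← expect_leaf hu hab.symm h hh]
  exact Finset.expect_congr rfl fun x _ => by rw [hs]

/-- Ordered triples of distinct indices. -/
def distinctTriples (ι : Type*) [Fintype ι] [DecidableEq ι] : Finset (ι × ι × ι) :=
  univ.filter fun t => t.1 ≠ t.2.1 ∧ t.1 ≠ t.2.2 ∧ t.2.1 ≠ t.2.2

/-- The weight of a cherry with centre `t.1` and leaves `t.2.1`, `t.2.2`. -/
def cherry (u v : X → X → ℝ) (t : ι × ι × ι) (x : ι → X) : ℝ :=
  u (x t.1) (x t.2.1) * v (x t.1) (x t.2.2)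

/-- The total weight of the cherries on distinct indices. -/
def cherryCount (u v : X → X → ℝ) (x : ι → X) : ℝ :=
  ∑ t ∈ distinctTriples ι, cherry u v t x

/-- A symmetric kernel with values in `[0,1]` all of whose row averages are `p`. -/
structure RegularKernel (u : X → X → ℝ) (p : ℝ) : Prop where
  symm : ∀ y z, u y z = u z y
  nonneg : ∀ y z, 0 ≤ u y z
  le_one : ∀ y z, u y z ≤ 1
  row : ∀ z, 𝔼 y, u z y = p

theorem RegularKernel.prob_nonneg {u : X → X → ℝ} {p : ℝ} (hu : RegularKernel u p) : 0 ≤ p := by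
  obtain ⟨z⟩ := ‹Nonempty X›
  rw [← hu.row z]
  exact Finset.expect_nonneg fun y _ => hu.nonneg z y

variable {u v : X → X → ℝ} {p q : ℝ}

theorem cherry_update {t : ι × ι × ι} {j : ι} (h1 : j ≠ t.1) (h2 : j ≠ t.2.1) (h3 : j ≠ t.2.2)
    (x : ι → X) (y : X) : cherry u v t (update x j y) = cherry u v t x := by
  simp [cherry, update_of_ne h1.symm, update_of_ne h2.symm, update_of_ne h3.symm]

/-- A factor that sees at most one vertex of the cherry leaves two free ones. A tree can always be
pruned there: a free leaf goes first, after which a free centre is itself a leaf of the remaining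
edge. -/
theorem expect_cherry_mul (hu : RegularKernel u p) (hv : RegularKernel v q) {t : ι × ι × ι}
    (ht : t ∈ distinctTriples ι) (h : (ι → X) → ℝ)
    (hh : ((∀ x y, h (update x t.2.1 y) = h x) ∧ (∀ x y, h (update x t.2.2 y) = h x)) ∨
      ((∀ x y, h (update x t.1 y) = h x) ∧ (∀ x y, h (update x t.2.2 y) = h x)) ∨
      ((∀ x y, h (update x t.1 y) = h x) ∧ (∀ x y, h (update x t.2.1 y) = h x))) :
    𝔼 x, cherry u v t x * h x = p * q * 𝔼 x, h x := by
  obtain ⟨a, b, c⟩ := t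
  simp only [distinctTriples, mem_filter, mem_univ, true_and] at ht hh
  obtain ⟨hab, hac, hbc⟩ := ht
  simp only [cherry]
  rcases hh with ⟨hb, hc⟩ | ⟨ha, hc⟩ | ⟨ha, hb⟩
  · simp_rw [mul_assoc]
    rw [expect_leaf hu.row hab, expect_leaf hv.row hac _ hc]
    intro x y
    simp [hb, update_of_ne hab, update_of_ne hbc.symm]
  · simp_rw [mul_comm (u _ _) (v _ _), mul_assoc]
    rw [expect_leaf hv.row hac, expect_leaf' hu.symm hu.row hab _ ha]
    · ring
    intro x y
    simp [hc, update_of_ne hac, update_of_ne hbc]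
  · simp_rw [mul_assoc]
    rw [expect_leaf hu.row hab, expect_leaf' hv.symm hv.row hac _ ha]
    intro x y
    simp [hb, update_of_ne hab, update_of_ne hbc.symm]

theorem expect_cherry (hu : RegularKernel u p) (hv : RegularKernel v q) {t : ι × ι × ι}
    (ht : t ∈ distinctTriples ι) : 𝔼 x, cherry u v t x = p * q := by
  have := expect_cherry_mul hu hv ht (fun _ => 1) (Or.inl ⟨fun _ _ => rfl, fun _ _ => rfl⟩)
  simpa using this

theorem cherry_nonneg (hu : RegularKernel u p) (hv : RegularKernel v q) (t : ι × ι × ι)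
    (x : ι → X) : 0 ≤ cherry u v t x :=
  mul_nonneg (hu.nonneg _ _) (hv.nonneg _ _)

theorem cherry_le_left (hu : RegularKernel u p) (hv : RegularKernel v q) (t : ι × ι × ι)
    (x : ι → X) : cherry u v t x ≤ u (x t.1) (x t.2.1) :=
  mul_le_of_le_one_right (hu.nonneg _ _) (hv.le_one _ _)

theorem cherry_le_right (hu : RegularKernel u p) (hv : RegularKernel v q) (t : ι × ι × ι)
    (x : ι → X) : cherry u v t x ≤ v (x t.1) (x t.2.2) :=
  mul_le_of_le_one_left (hv.nonneg _ _) (hu.le_one _ _)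

/-- The vertices of a cherry. -/
def support (t : ι × ι × ι) : Finset ι := {t.1, t.2.1, t.2.2}

theorem card_support_le (t : ι × ι × ι) : (support t).card ≤ 3 := Finset.card_le_three

theorem cherry_update_of_notMem {t : ι × ι × ι} {j : ι} (hj : j ∉ support t)
    (x : ι → X) (y : X) : cherry u v t (update x j y) = cherry u v t x := by
  simp only [support, mem_insert, mem_singleton, not_or] at hj
  exact cherry_update hj.1 hj.2.1 hj.2.2 x y

/-- With at most one shared vertex the two cherries are uncorrelated. With two, one edge of `s` is
bounded by 1 and the other, having a free endpoint, contributes `p` or `q`. With three, all of `s`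
is bounded by 1. The indicators record these cases and are separate factors so that their sum over
`s` factorizes. -/
theorem expect_cherry_mul_cherry_le (hu : RegularKernel u p) (hv : RegularKernel v q)
    {t s : ι × ι × ι} (ht : t ∈ distinctTriples ι) (hs : s ∈ distinctTriples ι) :
    𝔼 x, cherry u v s x * cherry u v t x - (p * q) ^ 2 ≤
      p * q * ((if s.1 ∈ support t then 1 else 0) *
          ((if s.2.1 ∈ support t then 1 else 0) * (if s.2.2 ∈ support t then 1 else 0))
        + p * ((if s.1 ∈ support t then 1 else 0) * (if s.2.2 ∈ support t then 1 else 0))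
        + q * ((if s.1 ∈ support t then 1 else 0) * (if s.2.1 ∈ support t then 1 else 0))
        + p * ((if s.2.1 ∈ support t then 1 else 0) * (if s.2.2 ∈ support t then 1 else 0))) := by
  have hp := hu.prob_nonneg
  have hq := hv.prob_nonneg
  have hs' := hs
  obtain ⟨a, b, c⟩ := s
  simp only [distinctTriples, mem_filter, mem_univ, true_and] at hs'
  obtain ⟨hab, hac, hbc⟩ := hs'
  have hpq : 0 ≤ (p * q) ^ 2 := by positivity
  have hpq' : 0 ≤ p * q := by positivity
  have hcomm : (𝔼 x, cherry u v t x) = p * q := expect_cherry hu hv ht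
  have mono : ∀ g : (ι → X) → ℝ, (∀ x, cherry u v (a, b, c) x ≤ g x) →
      𝔼 x, cherry u v (a, b, c) x * cherry u v t x ≤ 𝔼 x, g x * cherry u v t x := fun g hg =>
    Finset.expect_le_expect fun x _ => mul_le_mul_of_nonneg_right (hg x) (cherry_nonneg hu hv t x)
  have two : (𝔼 x, cherry u v (a, b, c) x * cherry u v t x = p * q * (p * q)) →
      𝔼 x, cherry u v (a, b, c) x * cherry u v t x - (p * q) ^ 2 ≤ 0 := fun h => by
    rw [h]; apply le_of_eq; ring
  by_cases ha : a ∈ support t <;> by_cases hb : b ∈ support t <;> by_cases hc : c ∈ support t <;>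
    simp only [ha, hb, hc, if_true, if_false, mul_one, mul_zero, add_zero, zero_add]
  · have h1 := mono (fun _ => 1) fun x =>
      (cherry_le_left hu hv _ x).trans (hu.le_one _ _)
    simp only [one_mul, hcomm] at h1
    have : p * q * 1 ≤ p * q * (1 + p + q + p) := mul_le_mul_of_nonneg_left (by linarith) hpq'
    linarith
  · have h1 := mono _ fun x => cherry_le_right hu hv _ x
    simp only at h1
    rw [expect_leaf hv.row hac _ (cherry_update_of_notMem hc), hcomm] at h1
    nlinarith
  · have h1 := mono _ fun x => cherry_le_left hu hv _ x
    simp only at h1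
    rw [expect_leaf hu.row hab _ (cherry_update_of_notMem hb), hcomm] at h1
    nlinarith
  · refine two ?_
    rw [expect_cherry_mul hu hv hs _ (Or.inl ⟨cherry_update_of_notMem hb,
      cherry_update_of_notMem hc⟩), hcomm]
  · have h1 := mono _ fun x => cherry_le_left hu hv _ x
    simp only at h1
    rw [expect_leaf' hu.symm hu.row hab _ (cherry_update_of_notMem ha), hcomm] at h1
    nlinarith
  · refine two ?_
    rw [expect_cherry_mul hu hv hs _ (Or.inr (Or.inl ⟨cherry_update_of_notMem ha,
      cherry_update_of_notMem hc⟩)), hcomm]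
  · refine two ?_
    rw [expect_cherry_mul hu hv hs _ (Or.inr (Or.inr ⟨cherry_update_of_notMem ha,
      cherry_update_of_notMem hb⟩)), hcomm]
  · refine two ?_
    rw [expect_cherry_mul hu hv hs _ (Or.inl ⟨cherry_update_of_notMem hb,
      cherry_update_of_notMem hc⟩), hcomm]

theorem card_distinctTriples_le : ((distinctTriples ι).card : ℝ) ≤ (Fintype.card ι : ℝ) ^ 3 := by
  have : (distinctTriples ι).card ≤ Fintype.card (ι × ι × ι) := Finset.card_le_univ _
  simp only [Fintype.card_prod] at this
  calc ((distinctTriples ι).card : ℝ) ≤ ((Fintype.card ι * (Fintype.card ι * Fintype.card ι) : ℕ) : ℝ) := by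
        exact_mod_cast this
    _ = _ := by push_cast; ring

theorem expect_cherryCount (hu : RegularKernel u p) (hv : RegularKernel v q) :
    𝔼 x : ι → X, cherryCount u v x = (distinctTriples ι).card * (p * q) := by
  simp only [cherryCount]
  rw [Finset.expect_sum_comm, Finset.sum_congr rfl fun t ht => expect_cherry hu hv ht]
  simp

theorem sum_triple (f g h : ι → ℝ) :
    ∑ s : ι × ι × ι, f s.1 * (g s.2.1 * h s.2.2) = (∑ i, f i) * ((∑ i, g i) * ∑ i, h i) := by
  rw [Fintype.sum_mul_sum, Fintype.sum_mul_sum, Fintype.sum_prod_type]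
  simp only [Fintype.sum_prod_type]
  refine Finset.sum_congr rfl fun i _ => ?_
  simp only [← Finset.mul_sum]

theorem sum_expect_cherry_mul_cherry_le (hu : RegularKernel u p) (hv : RegularKernel v q)
    {t : ι × ι × ι} (ht : t ∈ distinctTriples ι) :
    ∑ s ∈ distinctTriples ι, (𝔼 x, cherry u v s x * cherry u v t x - (p * q) ^ 2) ≤
      p * q * (27 + 18 * (Fintype.card ι * p) + 9 * (Fintype.card ι * q)) := by
  have hp := hu.prob_nonneg
  have hq := hv.prob_nonneg
  refine (Finset.sum_le_sum fun s hs => expect_cherry_mul_cherry_le hu hv ht hs).trans ?_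
  -- Dropping distinctness turns the sum into a product of sums over single vertices. The
  -- coefficients are 27 = 3³ for three shared vertices and 9 = 3² for each way of sharing two.
  refine (Finset.sum_le_sum_of_subset_of_nonneg (Finset.subset_univ _) fun s _ _ => by
    positivity).trans ?_
  rw [← Finset.mul_sum]
  refine mul_le_mul_of_nonneg_left ?_ (by positivity)
  set χ : ι → ℝ := fun i => if i ∈ support t then 1 else 0 with hχ
  have hsum : ∑ i, χ i = (support t).card := by simp [hχ]
  have hone : ∑ _i : ι, (1 : ℝ) = Fintype.card ι := by simp
  have h111 := sum_triple χ χ χ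
  have h101 := sum_triple χ (fun _ => 1) χ
  have h110 := sum_triple χ χ (fun _ => 1)
  have h011 := sum_triple (fun _ => 1) χ χ
  simp only [one_mul, mul_one, hsum, hone] at h111 h101 h110 h011
  rw [Finset.sum_add_distrib, Finset.sum_add_distrib, Finset.sum_add_distrib, ← Finset.mul_sum,
    ← Finset.mul_sum, ← Finset.mul_sum, h111, h101, h110, h011]
  have hk : ((support t).card : ℝ) ≤ 3 := by exact_mod_cast card_support_le t
  have hk0 : (0 : ℝ) ≤ (support t).card := by positivity
  set k : ℝ := ((support t).card : ℝ)
  have hN : (0 : ℝ) ≤ Fintype.card ι := by positivity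
  set N : ℝ := (Fintype.card ι : ℝ)
  have h2 : k * k ≤ 9 := by nlinarith
  have h3 : k * (k * k) ≤ 27 := by nlinarith
  have h4 : N * p * (k * k) ≤ N * p * 9 := mul_le_mul_of_nonneg_left h2 (by positivity)
  have h5 : N * q * (k * k) ≤ N * q * 9 := mul_le_mul_of_nonneg_left h2 (by positivity)
  nlinarith

/-- The variance of the number of cherries. -/
theorem expect_cherryCount_sub_sq_le (hu : RegularKernel u p) (hv : RegularKernel v q) :
    𝔼 x : ι → X, (cherryCount u v x - (distinctTriples ι).card * (p * q)) ^ 2 ≤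
      (Fintype.card ι : ℝ) ^ 3 *
        (p * q * (27 + 18 * (Fintype.card ι * p) + 9 * (Fintype.card ι * q))) := by
  have hp := hu.prob_nonneg
  have hq := hv.prob_nonneg
  set M : ℝ := ((distinctTriples ι).card : ℝ) with hM
  have h1 : 𝔼 x : ι → X, (cherryCount u v x - M * (p * q)) ^ 2 =
      𝔼 x : ι → X, cherryCount u v x * cherryCount u v x - (M * (p * q)) ^ 2 := by
    have : ∀ x : ι → X, (cherryCount u v x - M * (p * q)) ^ 2 =
        cherryCount u v x * cherryCount u v x - (2 * (M * (p * q))) * cherryCount u v x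
          + (M * (p * q)) ^ 2 := fun x => by ring
    simp_rw [this]
    rw [Finset.expect_add_distrib, Finset.expect_sub_distrib, ← Finset.mul_expect,
      expect_cherryCount hu hv, Finset.expect_const univ_nonempty]
    ring
  have h2 : 𝔼 x : ι → X, cherryCount u v x * cherryCount u v x - (M * (p * q)) ^ 2 =
      ∑ t ∈ distinctTriples ι, ∑ s ∈ distinctTriples ι,
        (𝔼 x, cherry u v s x * cherry u v t x - (p * q) ^ 2) := by
    have h3 : ∀ x : ι → X, cherryCount u v x * cherryCount u v x =
        ∑ t ∈ distinctTriples ι, ∑ s ∈ distinctTriples ι, cherry u v s x * cherry u v t x := by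
      intro x
      rw [cherryCount, Finset.sum_mul_sum, Finset.sum_comm]
    simp_rw [h3]
    rw [Finset.expect_sum_comm]
    simp_rw [Finset.expect_sum_comm, Finset.sum_sub_distrib, sum_const, nsmul_eq_mul]
    rw [← hM]
    ring
  rw [h1, h2]
  refine (Finset.sum_le_sum fun t ht => sum_expect_cherry_mul_cherry_le hu hv ht).trans ?_
  rw [sum_const, nsmul_eq_mul]
  exact mul_le_mul_of_nonneg_right card_distinctTriples_le (by positivity)

end Expectation

/-! ### First moment of four-cycles, and the Chebyshev and Markov inequalities -/

section Expectation

variable {ι X : Type*} [Fintype ι] [DecidableEq ι] [Fintype X] [Nonempty X]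

/-- Ordered quadruples of distinct indices. -/
def distinctQuads (ι : Type*) [Fintype ι] [DecidableEq ι] : Finset (ι × ι × ι × ι) :=
  univ.filter fun t => t.1 ≠ t.2.1 ∧ t.1 ≠ t.2.2.1 ∧ t.1 ≠ t.2.2.2 ∧ t.2.1 ≠ t.2.2.1 ∧
    t.2.1 ≠ t.2.2.2 ∧ t.2.2.1 ≠ t.2.2.2

/-- The total weight of the four-cycles on distinct indices. -/
def squareCount (u : X → X → ℝ) (x : ι → X) : ℝ :=
  ∑ t ∈ distinctQuads ι, u (x t.1) (x t.2.1) * u (x t.2.1) (x t.2.2.1) *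
    u (x t.2.2.1) (x t.2.2.2) * u (x t.2.2.2) (x t.1)

theorem expect_four {a b c d : ι} (hab : a ≠ b) (hac : a ≠ c) (had : a ≠ d) (hbc : b ≠ c)
    (hbd : b ≠ d) (hcd : c ≠ d) (F : X → X → X → X → ℝ) :
    𝔼 x : ι → X, F (x a) (x b) (x c) (x d) = 𝔼 w : X, 𝔼 z : X, 𝔼 y : X, 𝔼 x : X, F x y z w := by
  rw [expect_resample a, expect_resample b, expect_resample c, expect_resample d]
  simp only [update_self, update_of_ne hab.symm, update_of_ne hac.symm,
    update_of_ne had.symm, update_of_ne hbc.symm, update_of_ne hbd.symm, update_of_ne hcd.symm]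
  rw [Fintype.expect_const]

theorem expect_squareCount_le (u : X → X → ℝ) {B : ℝ} (hB0 : 0 ≤ B)
    (hB : 𝔼 w : X, 𝔼 z : X, 𝔼 y : X, 𝔼 x : X, u x y * u y z * u z w * u w x ≤ B) :
    𝔼 x : ι → X, squareCount u x ≤ (Fintype.card ι : ℝ) ^ 4 * B := by
  simp only [squareCount]
  rw [Finset.expect_sum_comm]
  have : ∀ t ∈ distinctQuads ι, 𝔼 x : ι → X, u (x t.1) (x t.2.1) * u (x t.2.1) (x t.2.2.1) *
      u (x t.2.2.1) (x t.2.2.2) * u (x t.2.2.2) (x t.1) ≤ B := by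
    rintro ⟨a, b, c, d⟩ ht
    simp only [distinctQuads, mem_filter, mem_univ, true_and] at ht
    obtain ⟨h1, h2, h3, h4, h5, h6⟩ := ht
    rw [expect_four h1 h2 h3 h4 h5 h6 fun x y z w => u x y * u y z * u z w * u w x]
    exact hB
  refine (Finset.sum_le_card_nsmul _ _ _ this).trans ?_
  rw [nsmul_eq_mul]
  refine mul_le_mul_of_nonneg_right ?_ hB0
  have h : (distinctQuads ι).card ≤ Fintype.card (ι × ι × ι × ι) := Finset.card_le_univ _
  simp only [Fintype.card_prod] at h
  calc ((distinctQuads ι).card : ℝ) ≤ ((Fintype.card ι * (Fintype.card ι *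
        (Fintype.card ι * Fintype.card ι)) : ℕ) : ℝ) := by exact_mod_cast h
    _ = _ := by push_cast; ring

open Classical in
/-- Chebyshev's inequality for the uniform distribution on a finite type. -/
theorem card_filter_le_of_expect_sq_le {Ω : Type*} [Fintype Ω] [Nonempty Ω] {f : Ω → ℝ}
    {m V s : ℝ} (hs : 0 < s) (hV : 𝔼 x, (f x - m) ^ 2 ≤ V) :
    ((univ.filter fun x => s < |f x - m|).card : ℝ) ≤ V / s ^ 2 * Fintype.card Ω := by
  have hΩ : (0 : ℝ) < Fintype.card Ω := by simp [Fintype.card_pos]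
  rw [Fintype.expect_eq_sum_div_card, div_le_iff₀ hΩ] at hV
  rw [div_mul_eq_mul_div, le_div_iff₀ (by positivity)]
  refine le_trans ?_ hV
  rw [← nsmul_eq_mul]
  refine (Finset.card_nsmul_le_sum _ (fun x => (f x - m) ^ 2) _ fun x hx => ?_).trans
    (Finset.sum_le_sum_of_subset_of_nonneg (Finset.subset_univ _) fun x _ _ => sq_nonneg _)
  have := (mem_filter.1 hx).2
  rw [← sq_abs (f x - m)]
  exact pow_le_pow_left₀ hs.le this.le 2

open Classical in
/-- Markov's inequality for the uniform distribution on a finite type. -/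
theorem card_filter_le_of_expect_le {Ω : Type*} [Fintype Ω] [Nonempty Ω] {f : Ω → ℝ}
    {V s : ℝ} (hf : ∀ x, 0 ≤ f x) (hs : 0 < s) (hV : 𝔼 x, f x ≤ V) :
    ((univ.filter fun x => s < f x).card : ℝ) ≤ V / s * Fintype.card Ω := by
  have hΩ : (0 : ℝ) < Fintype.card Ω := by simp [Fintype.card_pos]
  rw [Fintype.expect_eq_sum_div_card, div_le_iff₀ hΩ] at hV
  rw [div_mul_eq_mul_div, le_div_iff₀ (by positivity)]
  refine le_trans ?_ hV
  rw [← nsmul_eq_mul]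
  exact (Finset.card_nsmul_le_sum _ f _ fun x hx => (mem_filter.1 hx).2.le).trans
    (Finset.sum_le_sum_of_subset_of_nonneg (Finset.subset_univ _) fun x _ _ => hf x)

end Expectation

/-! ### Distance kernels on the cube and the density of four-cycles -/

section Kernels

/-- The indicator of the Hamming distance lying in `S`. -/
noncomputable def distKernel (n : ℕ) (S : Finset ℕ) (y z : Cube n) : ℝ := if hammingDist y z ∈ S then 1 else 0

/-- The proportion of points of the cube at distance in `S` from a given point. -/
noncomputable def sphereDensity (n : ℕ) (S : Finset ℕ) : ℝ := (∑ l ∈ S, (n.choose l : ℝ)) / 2 ^ n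

theorem card_hammingDist_eq {n : ℕ} (z : Cube n) (l : ℕ) :
    (univ.filter fun y : Cube n => hammingDist z y = l).card = n.choose l := by
  have h : (Finset.powersetCard l (univ : Finset (Fin n))).card = n.choose l := by simp
  rw [← h]
  refine Finset.card_nbij' (fun y => univ.filter fun j => z j ≠ y j)
    (fun A j => if j ∈ A then !(z j) else z j) ?_ ?_ ?_ ?_
  · intro y hy
    simpa [hammingDist, mem_powersetCard] using hy
  · intro A hA
    rw [mem_coe, mem_powersetCard] at hA
    rw [mem_coe, mem_filter, hammingDist, ← hA.2]
    refine ⟨mem_univ _, ?_⟩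
    congr 1
    ext j
    simp only [mem_filter, mem_univ, true_and]
    by_cases hj : j ∈ A <;> simp [hj]
  · intro y _
    funext j
    simp only [mem_filter, mem_univ, true_and]
    by_cases hj : z j = y j
    · simp [hj]
    · simp only [ne_eq, hj, not_false_eq_true, if_true]
      revert hj; cases z j <;> cases y j <;> simp
  · intro A _
    ext j
    simp only [mem_filter, mem_univ, true_and]
    by_cases hj : j ∈ A <;> simp [hj]

theorem distKernel_regular (n : ℕ) (S : Finset ℕ) :
    RegularKernel (distKernel n S) (sphereDensity n S) where
  symm y z := by simp only [distKernel, hammingDist_comm]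
  nonneg y z := by unfold distKernel; split_ifs <;> norm_num
  le_one y z := by unfold distKernel; split_ifs <;> norm_num
  row z := by
    rw [Fintype.expect_eq_sum_div_card]
    have hc : (Fintype.card (Cube n) : ℝ) = 2 ^ n := by simp
    rw [hc, sphereDensity]
    congr 1
    have : ∀ y : Cube n, distKernel n S z y =
        ∑ l ∈ S, if hammingDist z y = l then (1 : ℝ) else 0 := by
      intro y; simp [distKernel]
    simp_rw [this]
    rw [Finset.sum_comm]
    refine Finset.sum_congr rfl fun l _ => ?_
    rw [← card_hammingDist_eq z l, Finset.card_filter]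
    push_cast
    rfl

/-- The exponential moment bound for the number of four-cycles in the distance graph. -/
theorem expect_square_le (n i : ℕ) {t : ℝ} (ht : 0 < t) :
    𝔼 w : Cube n, 𝔼 z : Cube n, 𝔼 y : Cube n, 𝔼 x : Cube n,
      distKernel n {i} x y * distKernel n {i} y z * distKernel n {i} z w * distKernel n {i} w x ≤
    (1 + 6 * t ^ 2 + t ^ 4) ^ n / (t ^ (4 * i) * 8 ^ n) := by
  -- Chernoff bound: the indicator of distance i is at most t^(distance − i), a product over
  -- coordinates.
  have hk : ∀ x y : Cube n, distKernel n {i} x y ≤ (t ^ i)⁻¹ * ∏ j, (if x j ≠ y j then t else 1) := by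
    intro x y
    have hprod : ∏ j, (if x j ≠ y j then t else 1) = t ^ hammingDist x y := by
      rw [Finset.prod_ite]; simp [hammingDist]
    rw [hprod]
    unfold distKernel
    split_ifs with h
    · rw [mem_singleton.1 h, inv_mul_cancel₀ (by positivity)]
    · positivity
  have hk0 : ∀ x y : Cube n, 0 ≤ distKernel n {i} x y := (distKernel_regular n {i}).nonneg
  set g : Bool → Bool → ℝ := fun a b => if a ≠ b then t else 1 with hg
  have hg0 : ∀ a b, 0 ≤ g a b := fun a b => by simp only [hg]; split_ifs <;> positivity
  have hbd : ∀ x y z w : Cube n, distKernel n {i} x y * distKernel n {i} y z *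
      distKernel n {i} z w * distKernel n {i} w x ≤ (t ^ (4 * i))⁻¹ *
        ∏ j, (g (x j) (y j) * g (y j) (z j) * g (z j) (w j) * g (w j) (x j)) := by
    intro x y z w
    have h0 : ∀ x y : Cube n, 0 ≤ (t ^ i)⁻¹ * ∏ j, g (x j) (y j) := fun x y =>
      (hk0 x y).trans (hk x y)
    refine (mul_le_mul (mul_le_mul (mul_le_mul (hk x y) (hk y z) (hk0 _ _) (h0 _ _)) (hk z w)
      (hk0 _ _) (mul_nonneg (h0 _ _) (h0 _ _))) (hk w x) (hk0 _ _)
      (mul_nonneg (mul_nonneg (h0 _ _) (h0 _ _)) (h0 _ _))).trans (le_of_eq ?_)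
    simp only [Finset.prod_mul_distrib]
    rw [pow_mul', ← inv_pow]
    ring
  -- The sum factorizes into n equal sums over closed walks of four bits. The number of flips is
  -- even: 2 walks have none, 12 have two and 2 have four.
  have hsum : ∑ w : Cube n, ∑ z : Cube n, ∑ y : Cube n, ∑ x : Cube n,
      ∏ j, (g (x j) (y j) * g (y j) (z j) * g (z j) (w j) * g (w j) (x j)) =
      (2 * (1 + 6 * t ^ 2 + t ^ 4)) ^ n := by
    have e1 : ∀ F : Fin n → Bool → ℝ, ∑ x : Cube n, ∏ j, F j (x j) = ∏ j, ∑ a, F j a := fun F =>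
      (Fintype.prod_sum F).symm
    have s1 : ∀ w z y : Cube n, ∑ x : Cube n,
        ∏ j, (g (x j) (y j) * g (y j) (z j) * g (z j) (w j) * g (w j) (x j)) =
        ∏ j, ∑ a, (g a (y j) * g (y j) (z j) * g (z j) (w j) * g (w j) a) := fun w z y =>
      e1 fun j a => g a (y j) * g (y j) (z j) * g (z j) (w j) * g (w j) a
    have s2 : ∀ w z : Cube n, ∑ y : Cube n,
        ∏ j, ∑ a, (g a (y j) * g (y j) (z j) * g (z j) (w j) * g (w j) a) =
        ∏ j, ∑ b, ∑ a, (g a b * g b (z j) * g (z j) (w j) * g (w j) a) := fun w z =>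
      e1 fun j b => ∑ a, (g a b * g b (z j) * g (z j) (w j) * g (w j) a)
    have s3 : ∀ w : Cube n, ∑ z : Cube n,
        ∏ j, ∑ b, ∑ a, (g a b * g b (z j) * g (z j) (w j) * g (w j) a) =
        ∏ j, ∑ c, ∑ b, ∑ a, (g a b * g b c * g c (w j) * g (w j) a) := fun w =>
      e1 fun j c => ∑ b, ∑ a, (g a b * g b c * g c (w j) * g (w j) a)
    have s4 : ∑ w : Cube n, ∏ j, ∑ c, ∑ b, ∑ a, (g a b * g b c * g c (w j) * g (w j) a) =
        ∏ _j : Fin n, ∑ d, ∑ c, ∑ b, ∑ a, (g a b * g b c * g c d * g d a) :=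
      e1 fun j d => ∑ c, ∑ b, ∑ a, (g a b * g b c * g c d * g d a)
    simp_rw [s1, s2, s3]
    rw [s4]
    simp only [Fintype.sum_bool, prod_const, card_univ, Fintype.card_fin]
    congr 1
    simp [hg]
    ring
  have h2 : (Fintype.card (Cube n) : ℝ) = 2 ^ n := by simp
  simp only [Fintype.expect_eq_sum_div_card, ← Finset.sum_div, h2]
  have hle := Finset.sum_le_sum fun w (_ : w ∈ (univ : Finset (Cube n))) =>
    Finset.sum_le_sum fun z (_ : z ∈ (univ : Finset (Cube n))) =>
    Finset.sum_le_sum fun y (_ : y ∈ (univ : Finset (Cube n))) =>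
    Finset.sum_le_sum fun x (_ : x ∈ (univ : Finset (Cube n))) => hbd x y z w
  simp only [← Finset.mul_sum] at hle
  rw [hsum] at hle
  rw [div_div, div_div, div_div, div_le_iff₀ (by positivity)]
  refine hle.trans (le_of_eq ?_)
  have h16 : (2 : ℝ) ^ n * (2 ^ n * 2 ^ n) = 8 ^ n := by rw [← mul_pow, ← mul_pow]; norm_num
  rw [mul_pow, ← h16]
  field_simp

end Kernels

/-! ### The law of the points as normalized counting -/

section Law

theorem pointsLaw_singleton (n N : ℕ) (x : Fin N → Cube n) :
    pointsLaw n N {x} = ENNReal.ofReal (1 / (Fintype.card (Fin N → Cube n) : ℝ)) := by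
  have h : (Set.univ.pi fun j => {x j} : Set (Fin N → Cube n)) = {x} := by
    ext y; simp [Set.mem_pi, funext_iff]
  rw [pointsLaw, ← h, Measure.pi_pi]
  simp only [PMF.toMeasure_apply_singleton _ _ (MeasurableSet.singleton _),
    PMF.uniformOfFintype_apply, prod_const, card_univ, Fintype.card_fin]
  rw [one_div, ENNReal.ofReal_inv_of_pos (by simp), ENNReal.ofReal_natCast,
    ← ENNReal.inv_pow]
  simp

theorem pointsLaw_isProbability (n N : ℕ) : IsProbabilityMeasure (pointsLaw n N) := by
  unfold pointsLaw; infer_instance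

open Classical in
theorem le_pointsLaw {n N : ℕ} {A : Set (Fin N → Cube n)} {δ : ℝ}
    (h : ((univ.filter fun x => x ∉ A).card : ℝ) ≤ δ * Fintype.card (Fin N → Cube n)) :
    1 - ENNReal.ofReal δ ≤ pointsLaw n N A := by
  have := pointsLaw_isProbability n N
  have hΩ : (0 : ℝ) < Fintype.card (Fin N → Cube n) := by simp
  have hc : pointsLaw n N Aᶜ ≤ ENNReal.ofReal δ := by
    have h1 : Aᶜ = ((univ.filter fun x => x ∉ A : Finset (Fin N → Cube n)) : Set _) := by
      ext; simp
    rw [h1, ← MeasureTheory.sum_measure_singleton]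
    simp only [pointsLaw_singleton, sum_const, nsmul_eq_mul]
    rw [← ENNReal.ofReal_natCast, ← ENNReal.ofReal_mul (by positivity)]
    refine ENNReal.ofReal_le_ofReal ?_
    rw [mul_one_div, div_le_iff₀ hΩ]
    exact h
  rw [tsub_le_iff_right]
  calc (1 : ENNReal) = pointsLaw n N (A ∪ Aᶜ) := by rw [Set.union_compl_self, measure_univ]
    _ ≤ pointsLaw n N A + pointsLaw n N Aᶜ := measure_union_le _ _
    _ ≤ _ := by gcongr

end Law

/-! ### Power sums of eigenvalues as traces -/

section Spectrum

theorem sum_eigenvalues_pow {V : Type*} [Fintype V] [DecidableEq V] {A : Matrix V V ℝ}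
    (hA : A.IsHermitian) (k : ℕ) : ∑ j, hA.eigenvalues j ^ k = (A ^ k).trace := by
  conv_rhs => rw [hA.spectral_theorem, ← map_pow, Unitary.conjStarAlgAut_apply,
    Matrix.trace_mul_comm, ← Matrix.mul_assoc, Unitary.coe_star_mul_self, Matrix.one_mul,
    Matrix.diagonal_pow, Matrix.trace_diagonal]
  rfl

theorem trace_sq {V : Type*} [Fintype V] [DecidableEq V] (A : Matrix V V ℝ) :
    (A ^ 2).trace = ∑ a, ∑ b, A a b * A b a := by
  simp [pow_two, Matrix.trace, Matrix.mul_apply]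

theorem trace_pow_four {V : Type*} [Fintype V] [DecidableEq V] (A : Matrix V V ℝ) :
    (A ^ 4).trace = ∑ a, ∑ b, ∑ c, ∑ d, A a b * A b c * A c d * A d a := by
  rw [show A ^ 4 = A * (A * (A * A)) by noncomm_ring]
  simp only [Matrix.trace, Matrix.diag_apply, Matrix.mul_apply, Finset.mul_sum, mul_assoc]

end Spectrum

/-! ### Deterministic bounds for the spectrum of the erased code -/

section Deterministic

variable {n N : ℕ}

/-- The indices of the points that are not erased. -/
def survivors (d₀ : ℕ) (x : Fin N → Cube n) : Finset (Fin N) :=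
  univ.filter fun a : Fin N => ∀ b, b ≠ a → d₀ ≤ hammingDist (x a) (x b)

theorem mem_survivors {d₀ : ℕ} {x : Fin N → Cube n} {a : Fin N} :
    a ∈ survivors d₀ x ↔ ∀ b, b ≠ a → d₀ ≤ hammingDist (x a) (x b) := by
  simp [survivors]

theorem erase_eq (d₀ : ℕ) (x : Fin N → Cube n) : erase d₀ x = (survivors d₀ x).image x := rfl

/-- Coinciding points are at distance 0 < `d₀` and are erased, so sums over the code become sums
over surviving indices. -/
theorem injOn_survivors {d₀ : ℕ} (hd : 1 ≤ d₀) (x : Fin N → Cube n) :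
    Set.InjOn x (survivors d₀ x) := by
  intro a ha b hb hab
  by_contra hne
  have := mem_survivors.1 ha b (Ne.symm hne)
  rw [hab, hammingDist_self] at this
  omega

theorem sum_erase {d₀ : ℕ} (hd : 1 ≤ d₀) (x : Fin N → Cube n) (f : Cube n → ℝ) :
    ∑ y : erase d₀ x, f y = ∑ a ∈ survivors d₀ x, f (x a) := by
  rw [Finset.sum_coe_sort (erase d₀ x) f, erase_eq, Finset.sum_image (injOn_survivors hd x)]

theorem adjMatrix_distGraph {i : ℕ} (hi : 1 ≤ i) (C : Finset (Cube n)) (y z : C) :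
    (distGraph C i).adjMatrix ℝ y z = distKernel n {i} y z := by
  rw [SimpleGraph.adjMatrix_apply, distKernel]
  refine if_congr ?_ rfl rfl
  rw [mem_singleton]
  refine ⟨fun h => h.2, fun h => ⟨?_, h⟩⟩
  rintro rfl
  rw [hammingDist_self] at h
  omega

theorem distKernel_mul_self (S : Finset ℕ) (y z : Cube n) :
    distKernel n S y z * distKernel n S y z = distKernel n S y z := by
  unfold distKernel; split_ifs <;> norm_num

theorem distKernel_self {i : ℕ} (hi : 1 ≤ i) (y : Cube n) : distKernel n {i} y y = 0 := by
  simp only [distKernel, hammingDist_self, mem_singleton]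
  rw [if_neg (by omega)]

/-- The total weight of the ordered pairs of indices. -/
def edgeSum {ι X : Type*} [Fintype ι] (u : X → X → ℝ) (x : ι → X) : ℝ :=
  ∑ a, ∑ b, u (x a) (x b)

theorem sum_eigenvalueVector_sq {d₀ i : ℕ} (hd : 1 ≤ d₀) (hi : 1 ≤ i) (x : Fin N → Cube n) :
    ∑ j, eigenvalueVector (erase d₀ x) i j ^ 2 =
      ∑ a ∈ survivors d₀ x, ∑ b ∈ survivors d₀ x, distKernel n {i} (x a) (x b) := by
  simp only [eigenvalueVector]
  rw [sum_eigenvalues_pow, trace_sq]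
  simp only [adjMatrix_distGraph hi]
  have h0 : ∀ y z : Cube n, distKernel n {i} y z * distKernel n {i} z y = distKernel n {i} y z :=
    fun y z => by rw [(distKernel_regular n {i}).symm z y, distKernel_mul_self]
  simp_rw [h0]
  set u := distKernel n {i}
  have h1 : ∀ y : Cube n, ∑ z : erase d₀ x, u y z = ∑ b ∈ survivors d₀ x, u y (x b) :=
    fun y => sum_erase hd x fun z => u y z
  simp_rw [h1]
  exact sum_erase hd x fun y => ∑ b ∈ survivors d₀ x, u y (x b)

theorem sum_eigenvalueVector_pow_four {d₀ i : ℕ} (hd : 1 ≤ d₀) (hi : 1 ≤ i) (x : Fin N → Cube n) :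
    ∑ j, eigenvalueVector (erase d₀ x) i j ^ 4 =
      ∑ a ∈ survivors d₀ x, ∑ b ∈ survivors d₀ x, ∑ c ∈ survivors d₀ x, ∑ d ∈ survivors d₀ x,
        distKernel n {i} (x a) (x b) * distKernel n {i} (x b) (x c) *
          distKernel n {i} (x c) (x d) * distKernel n {i} (x d) (x a) := by
  simp only [eigenvalueVector]
  rw [sum_eigenvalues_pow, trace_pow_four]
  simp only [adjMatrix_distGraph hi]
  set u := distKernel n {i}
  have h1 : ∀ y z w : Cube n, ∑ v : erase d₀ x, u y z * u z w * u w v * u v y =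
      ∑ d ∈ survivors d₀ x, u y z * u z w * u w (x d) * u (x d) y := fun y z w =>
    sum_erase hd x fun v => u y z * u z w * u w v * u v y
  simp_rw [h1]
  have h2 : ∀ y z : Cube n, ∑ w : erase d₀ x, ∑ d ∈ survivors d₀ x,
      u y z * u z w * u w (x d) * u (x d) y = ∑ c ∈ survivors d₀ x, ∑ d ∈ survivors d₀ x,
      u y z * u z (x c) * u (x c) (x d) * u (x d) y := fun y z =>
    sum_erase hd x fun w => ∑ d ∈ survivors d₀ x, u y z * u z w * u w (x d) * u (x d) y
  simp_rw [h2]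
  have h3 : ∀ y : Cube n, ∑ z : erase d₀ x, ∑ c ∈ survivors d₀ x, ∑ d ∈ survivors d₀ x,
      u y z * u z (x c) * u (x c) (x d) * u (x d) y = ∑ b ∈ survivors d₀ x,
      ∑ c ∈ survivors d₀ x, ∑ d ∈ survivors d₀ x,
      u y (x b) * u (x b) (x c) * u (x c) (x d) * u (x d) y := fun y =>
    sum_erase hd x fun z => ∑ c ∈ survivors d₀ x, ∑ d ∈ survivors d₀ x,
      u y z * u z (x c) * u (x c) (x d) * u (x d) y
  simp_rw [h3]
  exact sum_erase hd x fun y => ∑ b ∈ survivors d₀ x,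
      ∑ c ∈ survivors d₀ x, ∑ d ∈ survivors d₀ x,
      u y (x b) * u (x b) (x c) * u (x c) (x d) * u (x d) y

theorem distinctTriples_sum (f : Fin N → Fin N → Fin N → ℝ) :
    ∑ t ∈ distinctTriples (Fin N), f t.1 t.2.1 t.2.2 =
      ∑ a, ∑ b, ∑ c, if a ≠ b ∧ a ≠ c ∧ b ≠ c then f a b c else 0 := by
  rw [distinctTriples, Finset.sum_filter, Fintype.sum_prod_type]
  simp only [Fintype.sum_prod_type]

/-- An edge from an erased `a` to `b` is charged to the cherry centred at `a` whose second leaf is a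
point `c` causing the erasure. Since `d₀ ≤ i`, the point `b` is not within the erasure distance, so
`c ≠ b`. -/
theorem sum_not_survivors_le {d₀ i : ℕ} (hi : 1 ≤ i) (hdi : d₀ ≤ i) (x : Fin N → Cube n) :
    ∑ a ∈ univ \ survivors d₀ x, ∑ b, distKernel n {i} (x a) (x b) ≤
      cherryCount (distKernel n {i}) (distKernel n (range d₀)) x := by
  have hu := distKernel_regular n {i}
  have hw := distKernel_regular n (range d₀)
  simp only [cherryCount, cherry]
  rw [distinctTriples_sum fun a b c =>
    distKernel n {i} (x a) (x b) * distKernel n (range d₀) (x a) (x c)]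
  have hnn : ∀ a b c : Fin N, 0 ≤ if a ≠ b ∧ a ≠ c ∧ b ≠ c then
      distKernel n {i} (x a) (x b) * distKernel n (range d₀) (x a) (x c) else 0 := by
    intro a b c
    split_ifs
    · exact mul_nonneg (hu.nonneg _ _) (hw.nonneg _ _)
    · exact le_rfl
  refine le_trans (Finset.sum_le_sum fun a ha => Finset.sum_le_sum fun b _ => ?_)
    (Finset.sum_le_sum_of_subset_of_nonneg (Finset.subset_univ _) fun a _ _ =>
      Finset.sum_nonneg fun b _ => Finset.sum_nonneg fun c _ => hnn a b c)
  rw [Finset.mem_sdiff, mem_survivors] at ha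
  obtain ⟨c, hca, hc⟩ := by simpa using ha.2
  by_cases hab : hammingDist (x a) (x b) = i
  · have h1 : a ≠ b := by rintro rfl; rw [hammingDist_self] at hab; omega
    have h2 : b ≠ c := by rintro rfl; omega
    refine le_trans ?_ (Finset.single_le_sum (fun c _ => hnn a b c) (mem_univ c))
    rw [if_pos ⟨h1, Ne.symm hca, h2⟩]
    simp [distKernel, hab, hc]
  · refine le_trans (le_of_eq ?_) (Finset.sum_nonneg fun c _ => hnn a b c)
    simp [distKernel, hab]

/-- Each lost ordered edge has an erased first or second endpoint; by symmetry both kinds obey the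
same bound, whence the factor 2. -/
theorem le_sum_survivors {d₀ i : ℕ} (hi : 1 ≤ i) (hdi : d₀ ≤ i) (x : Fin N → Cube n) :
    edgeSum (distKernel n {i}) x
        - 2 * cherryCount (distKernel n {i}) (distKernel n (range d₀)) x ≤
      ∑ a ∈ survivors d₀ x, ∑ b ∈ survivors d₀ x, distKernel n {i} (x a) (x b) := by
  have hu := distKernel_regular n {i}
  have h1 := sum_not_survivors_le hi hdi x
  have h2 : edgeSum (distKernel n {i}) x =
      ∑ a ∈ univ \ survivors d₀ x, ∑ b, distKernel n {i} (x a) (x b) +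
      ∑ a ∈ survivors d₀ x, ∑ b, distKernel n {i} (x a) (x b) :=
    (Finset.sum_sdiff (Finset.subset_univ _)).symm
  have h3 : ∑ a ∈ survivors d₀ x, ∑ b, distKernel n {i} (x a) (x b) =
      ∑ a ∈ survivors d₀ x, ∑ b ∈ univ \ survivors d₀ x, distKernel n {i} (x a) (x b) +
      ∑ a ∈ survivors d₀ x, ∑ b ∈ survivors d₀ x, distKernel n {i} (x a) (x b) := by
    rw [← Finset.sum_add_distrib]
    exact Finset.sum_congr rfl fun a _ => (Finset.sum_sdiff (Finset.subset_univ _)).symm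
  have h4 : ∑ a ∈ survivors d₀ x, ∑ b ∈ univ \ survivors d₀ x, distKernel n {i} (x a) (x b) ≤
      ∑ a ∈ univ \ survivors d₀ x, ∑ b, distKernel n {i} (x a) (x b) := by
    rw [Finset.sum_comm]
    refine Finset.sum_le_sum fun b _ => ?_
    refine (Finset.sum_le_sum_of_subset_of_nonneg (Finset.subset_univ _)
      fun a _ _ => hu.nonneg _ _).trans (le_of_eq ?_)
    exact Finset.sum_congr rfl fun a _ => hu.symm _ _
  linarith

theorem sum_mul_distKernel {i : ℕ} (hi : 1 ≤ i) (x : Fin N → Cube n) :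
    ∑ a, ∑ b, ∑ d, distKernel n {i} (x a) (x b) * distKernel n {i} (x a) (x d) =
      edgeSum (distKernel n {i}) x + cherryCount (distKernel n {i}) (distKernel n {i}) x := by
  set u := distKernel n {i} with hu
  simp only [cherryCount, cherry, edgeSum]
  rw [distinctTriples_sum fun a b c => u (x a) (x b) * u (x a) (x c)]
  have h1 : ∀ a b d : Fin N, u (x a) (x b) * u (x a) (x d) = (if b = d then u (x a) (x b) else 0) +
      (if a ≠ b ∧ a ≠ d ∧ b ≠ d then u (x a) (x b) * u (x a) (x d) else 0) := by
    intro a b d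
    by_cases hbd : b = d
    · subst hbd
      simp [hu, distKernel_mul_self]
    by_cases hab : a = b
    · subst hab
      simp [hu, hbd, distKernel_self hi]
    by_cases had : a = d
    · subst had
      simp [hu, hbd, distKernel_self hi]
    simp [hbd, hab, had]
  rw [Finset.sum_congr rfl fun a _ => Finset.sum_congr rfl fun b _ =>
    Finset.sum_congr rfl fun d _ => h1 a b d]
  simp only [Finset.sum_add_distrib, Finset.sum_ite_eq, mem_univ, if_true]

/-- Neighbours on a closed 4-walk are distinct, as the kernel vanishes on the diagonal. Hence a
degenerate walk has `a = c` or `b = d`, and each case leaves a sum over pairs of edges at a common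
vertex. -/
theorem sum_four_le {i : ℕ} (hi : 1 ≤ i) (x : Fin N → Cube n) :
    ∑ a, ∑ b, ∑ c, ∑ d, distKernel n {i} (x a) (x b) * distKernel n {i} (x b) (x c) *
          distKernel n {i} (x c) (x d) * distKernel n {i} (x d) (x a) ≤
      2 * (edgeSum (distKernel n {i}) x + cherryCount (distKernel n {i}) (distKernel n {i}) x) +
        squareCount (distKernel n {i}) x := by
  rw [← sum_mul_distKernel hi]
  have hr := distKernel_regular n {i}
  have hms := distKernel_mul_self (n := n) {i}
  have hself := distKernel_self (n := n) hi
  set u := distKernel n {i} with hu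
  have hsq : squareCount u x = ∑ a, ∑ b, ∑ c, ∑ d,
      if a ≠ b ∧ a ≠ c ∧ a ≠ d ∧ b ≠ c ∧ b ≠ d ∧ c ≠ d then
        u (x a) (x b) * u (x b) (x c) * u (x c) (x d) * u (x d) (x a) else 0 := by
    rw [squareCount, distinctQuads, Finset.sum_filter]
    simp only [Fintype.sum_prod_type]
  have hac : ∑ a, ∑ b, ∑ d, u (x a) (x b) * u (x a) (x d) =
      ∑ a, ∑ b, ∑ c, ∑ d, if a = c then u (x a) (x b) * u (x a) (x d) else 0 := by
    refine Finset.sum_congr rfl fun a _ => Finset.sum_congr rfl fun b _ => ?_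
    rw [Finset.sum_comm]
    simp
  have hbd : ∑ a, ∑ b, ∑ d, u (x a) (x b) * u (x a) (x d) =
      ∑ a, ∑ b, ∑ c, ∑ d, if b = d then u (x b) (x a) * u (x b) (x c) else 0 := by
    rw [Finset.sum_comm]
    refine Finset.sum_congr rfl fun a _ => ?_
    simp only [Finset.sum_ite_eq, mem_univ, if_true]
  rw [hsq, two_mul]
  nth_rewrite 1 [hac]
  rw [hbd]
  simp only [← Finset.sum_add_distrib]
  refine Finset.sum_le_sum fun a _ => Finset.sum_le_sum fun b _ => Finset.sum_le_sum fun c _ =>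
    Finset.sum_le_sum fun d _ => ?_
  have hn := hr.nonneg
  have h1 := hr.le_one
  have g1 : 0 ≤ u (x a) (x b) * u (x a) (x d) := mul_nonneg (hn _ _) (hn _ _)
  have g2 : 0 ≤ u (x b) (x a) * u (x b) (x c) := mul_nonneg (hn _ _) (hn _ _)
  by_cases eac : a = c
  · subst eac
    have : u (x a) (x b) * u (x b) (x a) * u (x a) (x d) * u (x d) (x a) =
        u (x a) (x b) * u (x a) (x d) := by
      rw [hr.symm (x b) (x a), hr.symm (x d) (x a), hms, mul_assoc, hms]
    rw [this]
    split_ifs <;> simp_all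
  by_cases ebd : b = d
  · subst ebd
    have : u (x a) (x b) * u (x b) (x c) * u (x c) (x b) * u (x b) (x a) =
        u (x b) (x a) * u (x b) (x c) := by
      rw [hr.symm (x c) (x b), hr.symm (x a) (x b), mul_assoc (u _ _) (u _ _) (u _ _), hms,
        mul_right_comm, hms]
    rw [this]
    simp [eac]
  by_cases eab : a = b
  · subst eab; simp [hself, eac, ebd]
  by_cases ebc : b = c
  · subst ebc; simp [hself, eac, ebd]
  by_cases ecd : c = d
  · subst ecd; simp [hself, eac, ebd]
  by_cases ead : a = d
  · subst ead; simp [hself, eac, ebd]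
  simp [eac, ebd, eab, ebc, ecd, ead]

theorem sum_eigenvalueVector_pow_four_le {d₀ i : ℕ} (hd : 1 ≤ d₀) (hi : 1 ≤ i)
    (x : Fin N → Cube n) :
    ∑ j, eigenvalueVector (erase d₀ x) i j ^ 4 ≤
      2 * (edgeSum (distKernel n {i}) x + cherryCount (distKernel n {i}) (distKernel n {i}) x) +
        squareCount (distKernel n {i}) x := by
  rw [sum_eigenvalueVector_pow_four hd hi]
  refine le_trans ?_ (sum_four_le hi x)
  have hn := (distKernel_regular n {i}).nonneg
  have hp : ∀ a b c d : Fin N, 0 ≤ distKernel n {i} (x a) (x b) * distKernel n {i} (x b) (x c) *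
      distKernel n {i} (x c) (x d) * distKernel n {i} (x d) (x a) := fun a b c d =>
    mul_nonneg (mul_nonneg (mul_nonneg (hn _ _) (hn _ _)) (hn _ _)) (hn _ _)
  have hsub := Finset.subset_univ (survivors d₀ x)
  refine (Finset.sum_le_sum fun a _ => (Finset.sum_le_sum fun b _ => (Finset.sum_le_sum fun c _ =>
    Finset.sum_le_sum_of_subset_of_nonneg hsub fun d _ _ => hp a b c d).trans
    (Finset.sum_le_sum_of_subset_of_nonneg hsub fun c _ _ => Finset.sum_nonneg fun d _ =>
      hp a b c d)).trans
    (Finset.sum_le_sum_of_subset_of_nonneg hsub fun b _ _ => Finset.sum_nonneg fun c _ =>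
      Finset.sum_nonneg fun d _ => hp a b c d)).trans
    (Finset.sum_le_sum_of_subset_of_nonneg hsub fun a _ _ => Finset.sum_nonneg fun b _ =>
      Finset.sum_nonneg fun c _ => Finset.sum_nonneg fun d _ => hp a b c d)

/-- The norm ratio in terms of power sums. -/
theorem uniformNorm_div_le {ι : Type*} [Fintype ι] {f : ι → ℝ} {m K : ℝ} (hK : 1 ≤ K)
    (hm : (Fintype.card ι : ℝ) ≤ m) (h2 : 0 < ∑ j, f j ^ 2)
    (h4 : m * ∑ j, f j ^ 4 ≤ K * (∑ j, f j ^ 2) ^ 2) :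
    f ≠ 0 ∧ uniformNorm 4 f / uniformNorm 2 f ≤ K := by
  have hne : f ≠ 0 := by
    rintro rfl
    simp at h2
  refine ⟨hne, ?_⟩
  have hι : Nonempty ι := by
    by_contra h
    rw [not_nonempty_iff] at h
    simp at h2
  have hc : (0 : ℝ) < Fintype.card ι := by simp [Fintype.card_pos]
  have e2 : ∀ j, |f j| ^ 2 = f j ^ 2 := fun j => sq_abs _
  have e4 : ∀ j, |f j| ^ 4 = f j ^ 4 := fun j => (by decide : Even 4).pow_abs _
  simp only [uniformNorm, e2, e4]
  set A := ∑ j, f j ^ 2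
  set B := ∑ j, f j ^ 4
  have hB : 0 ≤ B := Finset.sum_nonneg fun j _ => by positivity
  set c : ℝ := (Fintype.card ι : ℝ)
  have hA' : 0 < A / c := by positivity
  have hle : B / c ≤ K * (A / c) ^ 2 := by
    rw [div_pow, ← mul_div_assoc, div_le_div_iff₀ hc (by positivity)]
    have : c * B ≤ K * A ^ 2 := (mul_le_mul_of_nonneg_right hm hB).trans h4
    nlinarith
  have hle2 : B / c ≤ (K * (A / c) ^ (1 / (2 : ℝ))) ^ 4 := by
    have : ((A / c) ^ (1 / (2 : ℝ))) ^ 4 = (A / c) ^ 2 := by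
      rw [← Real.sqrt_eq_rpow, show 4 = 2 * 2 by norm_num, pow_mul, Real.sq_sqrt hA'.le]
    rw [mul_pow, this]
    refine hle.trans (mul_le_mul_of_nonneg_right ?_ (by positivity))
    -- The fourth power of the ratio is at most K, hence at most K⁴ because K ≥ 1. This avoids
    -- taking a fourth root of the constant.
    exact le_self_pow₀ hK (by norm_num)
  push_cast
  rw [div_le_iff₀ (by positivity)]
  calc (B / c) ^ (1 / (4 : ℝ)) ≤ ((K * (A / c) ^ (1 / (2 : ℝ))) ^ 4) ^ (1 / (4 : ℝ)) :=
        Real.rpow_le_rpow (by positivity) hle2 (by norm_num)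
    _ = _ := by
        rw [show (1 / (4 : ℝ)) = ((4 : ℕ) : ℝ)⁻¹ by norm_num]
        exact Real.pow_rpow_inv_natCast (by positivity) (by norm_num)

end Deterministic

/-! ### Binomial estimates and the exponential gain for four-cycles -/

section Binomial

theorem choose_succ_mul (n k : ℕ) (hk : k ≤ n) :
    (n.choose (k + 1) : ℝ) * ((k : ℝ) + 1) = n.choose k * ((n : ℝ) - k) := by
  have := Nat.choose_succ_right_eq n k
  rw [← Nat.cast_sub hk]
  exact_mod_cast this

/-- A term of the binomial expansion at its mode is at least the average term. -/
theorem one_add_pow_le_choose_mul {n i : ℕ} (hin : i < n) (h0 : 0 < i) :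
    (1 + (i : ℝ) / (n - i)) ^ n ≤ (n + 1) * (n.choose i * ((i : ℝ) / (n - i)) ^ i) := by
  have hi : (0 : ℝ) < i := by exact_mod_cast h0
  have hni : (0 : ℝ) < (n : ℝ) - i := sub_pos.2 (by exact_mod_cast hin)
  set y : ℝ := (i : ℝ) / (n - i) with hy
  have hy0 : 0 < y := div_pos hi hni
  have hyi : y * (n - i) = i := div_mul_cancel₀ _ hni.ne'
  -- Ratio of consecutive terms of (1 + y)ⁿ: it is at least 1 before index i and at most 1 from i
  -- on, so term i is the largest of the n+1 terms.
  have step : ∀ j, j ≤ n → (n.choose (j + 1) * y ^ (j + 1)) * (((j : ℝ) + 1) * (n - i)) =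
      (n.choose j * y ^ j) * ((n - j) * i) := by
    intro j hj
    have := choose_succ_mul n j hj
    calc (n.choose (j + 1) * y ^ (j + 1)) * (((j : ℝ) + 1) * (n - i)) =
        (n.choose (j + 1) * ((j : ℝ) + 1)) * y ^ j * (y * (n - i)) := by ring
      _ = _ := by rw [this, hyi]; ring
  have hnn : ∀ j, 0 ≤ (n.choose j : ℝ) * y ^ j := fun j => by positivity
  have up : ∀ m, m ≤ i → (n.choose (i - m) : ℝ) * y ^ (i - m) ≤ n.choose i * y ^ i := by
    intro m
    induction m with
    | zero => intro _; simp
    | succ m ih =>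
      intro hm
      refine le_trans ?_ (ih (by omega))
      obtain ⟨j, hj⟩ : ∃ j, i = j + (m + 1) := ⟨i - (m + 1), by omega⟩
      rw [show i - (m + 1) = j by omega, show i - m = j + 1 by omega]
      have h1 := step j (by omega)
      have hji : (j : ℝ) + 1 ≤ i := by exact_mod_cast (by omega : j + 1 ≤ i)
      have hj0 : (0 : ℝ) ≤ j := by positivity
      have hle : ((j : ℝ) + 1) * (n - i) ≤ (n - j) * i := by nlinarith
      have hpos : 0 < ((j : ℝ) + 1) * (n - i) := by positivity
      refine le_of_mul_le_mul_right ?_ hpos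
      rw [h1]
      exact mul_le_mul_of_nonneg_left hle (hnn j)
  have down : ∀ m, i + m ≤ n → (n.choose (i + m) : ℝ) * y ^ (i + m) ≤ n.choose i * y ^ i := by
    intro m
    induction m with
    | zero => intro _; simp
    | succ m ih =>
      intro hm
      refine le_trans ?_ (ih (by omega))
      have h1 := step (i + m) (by omega)
      have hmn : (i : ℝ) + m ≤ n := by exact_mod_cast (by omega : i + m ≤ n)
      have hm0 : (0 : ℝ) ≤ m := by positivity
      push_cast at h1
      have hle : ((n : ℝ) - (i + m)) * i ≤ ((i + m : ℝ) + 1) * (n - i) := by nlinarith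
      have hpos : 0 < ((i + m : ℝ) + 1) * (n - i) := by positivity
      refine le_of_mul_le_mul_right ?_ hpos
      rw [← add_assoc, h1]
      exact mul_le_mul_of_nonneg_left hle (hnn _)
  have hterm : ∀ j ∈ range (n + 1), y ^ j * 1 ^ (n - j) * (n.choose j : ℝ) ≤ n.choose i * y ^ i := by
    intro j hj
    rw [mem_range] at hj
    rw [one_pow, mul_one, mul_comm]
    rcases le_total j i with h | h
    · have := up (i - j) (by omega)
      rwa [show i - (i - j) = j by omega] at this
    · have := down (j - i) (by omega)
      rwa [show i + (j - i) = j by omega] at this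
  rw [add_comm, add_pow]
  refine (Finset.sum_le_card_nsmul _ _ _ hterm).trans (le_of_eq ?_)
  rw [card_range, nsmul_eq_mul]
  push_cast
  ring

/-- Going down from `k`, the coefficients decay at least geometrically with ratio β/(1−β); the
constant is the sum of that series. -/
theorem sum_choose_le {n : ℕ} {β : ℝ} (hβ : β < 1 / 2) (hβ0 : 0 ≤ β) :
    ∀ k : ℕ, (k : ℝ) ≤ β * n →
      ∑ l ∈ range (k + 1), (n.choose l : ℝ) ≤ (1 - β) / (1 - 2 * β) * n.choose k := by
  have h2 : 0 < 1 - 2 * β := by linarith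
  intro k
  induction k with
  | zero =>
    intro _
    simp only [zero_add, sum_range_one, Nat.choose_zero_right, Nat.cast_one, mul_one]
    rw [le_div_iff₀ h2]
    linarith
  | succ k ih =>
    intro hk
    push_cast at hk
    have hn : (0 : ℝ) ≤ n := by positivity
    rw [Finset.sum_range_succ]
    have h1 := ih (by linarith)
    have hkn : k ≤ n := by
      have : (k : ℝ) ≤ n := by nlinarith
      exact_mod_cast this
    have hc := choose_succ_mul n k hkn
    have hA : (0 : ℝ) ≤ n.choose (k + 1) := by positivity
    have hB : (0 : ℝ) ≤ n.choose k := by positivity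
    set A : ℝ := (n.choose (k + 1) : ℝ)
    set B : ℝ := (n.choose k : ℝ)
    have hn0 : (0 : ℝ) < n := by
      rcases hn.lt_or_eq with h | h
      · exact h
      · rw [← h] at hk
        have : (0 : ℝ) ≤ k := by positivity
        linarith
    have hBA : B * (1 - β) ≤ A * β := by
      have e1 : B * ((1 - β) * n) ≤ B * (n - k) := mul_le_mul_of_nonneg_left (by linarith) hB
      have e2 : A * ((k : ℝ) + 1) ≤ A * (β * n) := mul_le_mul_of_nonneg_left hk hA
      refine le_of_mul_le_mul_right ?_ hn0
      linarith
    calc _ ≤ (1 - β) / (1 - 2 * β) * B + A := by linarith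
      _ = (B * (1 - β) + A * (1 - 2 * β)) / (1 - 2 * β) := by
          rw [add_div, mul_div_cancel_right₀ _ h2.ne']; ring
      _ ≤ (A * (1 - β)) / (1 - 2 * β) := by
          refine div_le_div_of_nonneg_right ?_ h2.le
          linarith
      _ = _ := by ring

theorem choose_add_le {n k : ℕ} {α : ℝ} (hα : 0 < α) (hk : α * n ≤ k + 1) (m : ℕ)
    (hkm : k + m ≤ n) : (n.choose (k + m) : ℝ) ≤ n.choose k * (1 / α) ^ m := by
  induction m with
  | zero => simp
  | succ m ih =>
    have h1 := ih (by omega)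
    have hc := choose_succ_mul n (k + m) (by omega)
    rw [← add_assoc, pow_succ, ← mul_assoc, mul_one_div, le_div_iff₀ hα]
    have hB : (0 : ℝ) ≤ n.choose (k + m) := by positivity
    have hA : (0 : ℝ) ≤ n.choose (k + m + 1) := by positivity
    refine le_trans ?_ h1
    have hn : (0 : ℝ) < n := by exact_mod_cast (by omega : 0 < n)
    push_cast at hc
    have hk0 : (0 : ℝ) ≤ k := by positivity
    have hm0 : (0 : ℝ) ≤ m := by positivity
    refine le_of_mul_le_mul_right ?_ hn
    have e1 : (n.choose (k + m + 1) : ℝ) * (α * n) ≤ n.choose (k + m + 1) * ((k : ℝ) + m + 1) :=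
      mul_le_mul_of_nonneg_left (by linarith) hA
    have e2 : (n.choose (k + m) : ℝ) * (n - (k + m)) ≤ n.choose (k + m) * n :=
      mul_le_mul_of_nonneg_left (by linarith) hB
    linarith

theorem choose_le_choose_of_le_half {n k : ℕ} (m : ℕ) (h : 2 * (k + m) ≤ n) :
    n.choose k ≤ n.choose (k + m) := by
  induction m with
  | zero => simp
  | succ m ih =>
    exact (ih (by omega)).trans (Nat.choose_le_succ_of_lt_half_left (by omega))

/-- The middle coefficient is at least 2ⁿ/(n+1), and each step down to `k` loses at most a factor 3
as long as `n ≤ 4 * k + 3`. -/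
theorem two_pow_le_choose {n : ℕ} (m : ℕ) : ∀ k : ℕ, k + m = n / 2 → n ≤ 4 * k + 3 →
    (2 : ℝ) ^ n ≤ (n + 1) * 3 ^ m * n.choose k := by
  induction m with
  | zero =>
    intro k hk _
    rw [add_zero] at hk
    have h1 : (2 : ℕ) ^ n ≤ (n + 1) * n.choose (n / 2) := by
      rw [← Nat.sum_range_choose]
      refine (Finset.sum_le_card_nsmul _ _ _ fun i _ => Nat.choose_le_middle i n).trans ?_
      simp
    rw [hk]
    simp only [pow_zero, mul_one]
    exact_mod_cast h1
  | succ m ih =>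
    intro k hk hn
    have h1 := ih (k + 1) (by omega) (by omega)
    refine h1.trans ?_
    have hkn : k ≤ n := by omega
    have hc := choose_succ_mul n k hkn
    have hB : (0 : ℝ) ≤ n.choose k := by positivity
    have hA : (0 : ℝ) ≤ n.choose (k + 1) := by positivity
    have hn' : (n : ℝ) ≤ 4 * k + 3 := by exact_mod_cast hn
    have hle : (n.choose (k + 1) : ℝ) ≤ 3 * n.choose k := by
      have hk1 : (0 : ℝ) < (k : ℝ) + 1 := by positivity
      refine le_of_mul_le_mul_right ?_ hk1
      rw [hc]
      nlinarith
    calc ((n : ℝ) + 1) * 3 ^ m * n.choose (k + 1) ≤ (n + 1) * 3 ^ m * (3 * n.choose k) :=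
          mul_le_mul_of_nonneg_left hle (by positivity)
      _ = _ := by ring

theorem sum_choose_mul_pow_le (n k : ℕ) {y : ℝ} (hy0 : 0 < y) (hy1 : y ≤ 1) (hk : k ≤ n) :
    (∑ l ∈ range k, (n.choose l : ℝ)) * y ^ k ≤ (1 + y) ^ n := by
  rw [add_comm, add_pow, Finset.sum_mul]
  refine (Finset.sum_le_sum fun l hl => ?_).trans
    (Finset.sum_le_sum_of_subset_of_nonneg (Finset.range_subset_range.2 (by omega : k ≤ n + 1))
      fun l _ _ => by positivity)
  rw [one_pow, mul_one, mul_comm]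
  refine mul_le_mul_of_nonneg_right ?_ (by positivity)
  exact pow_le_pow_of_le_one hy0.le hy1 (mem_range.1 hl).le

/-- With z = √y and t² = z³, the identity (1+z²)³ − (1+6z³+z⁶) = 3z²(1−z)² yields a gap that is
uniform for y away from 0 and 1. Since (1+y)³ ≤ 8, this additive gap becomes the factor `ρ`. -/
theorem exists_square_base {y₀ y₁ : ℝ} (h0 : 0 < y₀) (h1 : y₁ < 1) (h01 : y₀ ≤ y₁) :
    ∃ ρ : ℝ, 0 < ρ ∧ ρ < 1 ∧ ∀ y : ℝ, y₀ ≤ y → y ≤ y₁ →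
      ∃ t : ℝ, 0 < t ∧ t ^ 4 = y ^ 3 ∧ 1 + 6 * t ^ 2 + t ^ 4 ≤ ρ * (1 + y) ^ 3 := by
  have hs1 : √y₁ < 1 := by
    rw [Real.sqrt_lt' one_pos]; linarith
  have hs0 : 0 ≤ √y₁ := Real.sqrt_nonneg _
  have hsq : 0 < (1 - √y₁) ^ 2 := by
    have : 0 < 1 - √y₁ := by linarith
    positivity
  have hsq1 : (1 - √y₁) ^ 2 ≤ 1 := by nlinarith
  refine ⟨1 - 3 * y₀ * (1 - √y₁) ^ 2 / 8, ?_, ?_, ?_⟩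
  · nlinarith
  · have : 0 < 3 * y₀ * (1 - √y₁) ^ 2 / 8 := by positivity
    linarith
  intro y hy0 hy1
  have hy : 0 < y := by linarith
  set z := √y with hz
  have hz0 : 0 < z := Real.sqrt_pos.2 hy
  have hzy : z ^ 2 = y := Real.sq_sqrt hy.le
  have hz1 : z ≤ √y₁ := Real.sqrt_le_sqrt hy1
  have ht2 : √(z ^ 3) ^ 2 = z ^ 3 := Real.sq_sqrt (by positivity)
  have ht4 : √(z ^ 3) ^ 4 = y ^ 3 := by
    rw [show 4 = 2 * 2 by norm_num, pow_mul, ht2, ← hzy]; ring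
  refine ⟨√(z ^ 3), Real.sqrt_pos.2 (by positivity), ht4, ?_⟩
  rw [ht4, ht2]
  have e1 : 1 + 6 * z ^ 3 + y ^ 3 = (1 + y) ^ 3 - 3 * (y * (1 - z) ^ 2) := by
    rw [← hzy]; ring
  have e2 : y₀ * (1 - √y₁) ^ 2 ≤ y * (1 - z) ^ 2 :=
    mul_le_mul hy0 (pow_le_pow_left₀ (by linarith) (by linarith) 2) hsq.le hy.le
  have e3 : (1 + y) ^ 3 ≤ 8 := by
    calc (1 + y) ^ 3 ≤ 2 ^ 3 := pow_le_pow_left₀ (by linarith) (by linarith) 3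
      _ = 8 := by norm_num
  have e4 : 3 * y₀ * (1 - √y₁) ^ 2 / 8 * (1 + y) ^ 3 ≤ 3 * y₀ * (1 - √y₁) ^ 2 / 8 * 8 :=
    mul_le_mul_of_nonneg_left e3 (by positivity)
  rw [e1]
  nlinarith

end Binomial

/-! ### Probability that the counts at one distance are typical -/

section Concentration

variable {n N : ℕ}

theorem sphereDensity_singleton (n i : ℕ) : sphereDensity n {i} = n.choose i / 2 ^ n := by
  simp [sphereDensity]

/-- The expected density of four-cycles is exponentially smaller than the cube of the density of
the sphere. -/
theorem expect_square_le_density {i : ℕ} (hi0 : 0 < i) (hin : i < n) {ρ t : ℝ} (ht : 0 < t)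
    (hρ : 0 < ρ) (ht4 : t ^ 4 = ((i : ℝ) / (n - i)) ^ 3)
    (hle : 1 + 6 * t ^ 2 + t ^ 4 ≤ ρ * (1 + (i : ℝ) / (n - i)) ^ 3) :
    𝔼 w : Cube n, 𝔼 z : Cube n, 𝔼 y : Cube n, 𝔼 x : Cube n,
      distKernel n {i} x y * distKernel n {i} y z * distKernel n {i} z w * distKernel n {i} w x ≤
    ρ ^ n * ((n : ℝ) + 1) ^ 3 * sphereDensity n {i} ^ 3 := by
  refine (expect_square_le n i ht).trans ?_
  have hi : (0 : ℝ) < i := by exact_mod_cast hi0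
  have hni : (0 : ℝ) < (n : ℝ) - i := sub_pos.2 (by exact_mod_cast hin)
  have hmode := one_add_pow_le_choose_mul hin hi0
  set y : ℝ := (i : ℝ) / (n - i) with hy
  have hy0 : 0 < y := div_pos hi hni
  have h8 : (8 : ℝ) ^ n = (2 ^ n) ^ 3 := by rw [← pow_mul, mul_comm, pow_mul]; norm_num
  rw [sphereDensity_singleton, h8, div_pow,
    show t ^ (4 * i) = (y ^ 3) ^ i by rw [pow_mul, ht4], ← mul_div_assoc, ← div_div]
  refine div_le_div_of_nonneg_right ?_ (by positivity)
  rw [div_le_iff₀ (by positivity)]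
  -- The choice t⁴ = y³ matches the cube of (1+y)ⁿ/yⁱ, which exceeds C(n,i) by at most the factor
  -- n+1 because i is the mode for this y.
  calc (1 + 6 * t ^ 2 + t ^ 4) ^ n ≤ (ρ * (1 + y) ^ 3) ^ n :=
        pow_le_pow_left₀ (by positivity) hle n
    _ = ρ ^ n * ((1 + y) ^ n) ^ 3 := by rw [mul_pow, pow_right_comm]
    _ ≤ ρ ^ n * ((n + 1) * (n.choose i * y ^ i)) ^ 3 := by gcongr
    _ = ρ ^ n * ((n : ℝ) + 1) ^ 3 * n.choose i ^ 3 * (y ^ 3) ^ i := by ring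

/-- The counts of edges, cherries and four-cycles at distance `i` have their typical size. -/
structure TypicalAt (d₀ i : ℕ) (x : Fin N → Cube n) : Prop where
  edge_ge : 7 / 8 * ((N : ℝ) ^ 2 * sphereDensity n {i}) ≤ edgeSum (distKernel n {i}) x
  edge_le : edgeSum (distKernel n {i}) x ≤ 2 * ((N : ℝ) ^ 2 * sphereDensity n {i})
  erased_le : cherryCount (distKernel n {i}) (distKernel n (range d₀)) x ≤
    1 / 8 * ((N : ℝ) ^ 2 * sphereDensity n {i})
  cherry_le : cherryCount (distKernel n {i}) (distKernel n {i}) x ≤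
    2 * ((N : ℝ) ^ 3 * sphereDensity n {i} ^ 2)
  square_le : squareCount (distKernel n {i}) x ≤ (N : ℝ) ^ 3 * sphereDensity n {i} ^ 2

theorem one_regularKernel {X : Type*} [Fintype X] [Nonempty X] :
    RegularKernel (fun _ _ : X => (1 : ℝ)) 1 where
  symm _ _ := rfl
  nonneg _ _ := zero_le_one
  le_one _ _ := le_rfl
  row _ := Fintype.expect_const _

theorem distinctTriples_sum_pair (hN : 2 ≤ N) (f : Fin N → Fin N → ℝ) :
    ∑ t ∈ distinctTriples (Fin N), f t.1 t.2.1 =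
      ((N : ℝ) - 2) * ∑ a, ∑ b, if a ≠ b then f a b else 0 := by
  rw [distinctTriples_sum fun a b _ => f a b, Finset.mul_sum]
  refine Finset.sum_congr rfl fun a _ => ?_
  rw [Finset.mul_sum]
  refine Finset.sum_congr rfl fun b _ => ?_
  by_cases hab : a = b
  · simp [hab]
  have h : (univ.filter fun c : Fin N => a ≠ b ∧ a ≠ c ∧ b ≠ c) = univ \ {a, b} := by
    ext c
    simp only [mem_filter, mem_univ, true_and, Finset.mem_sdiff, mem_insert, mem_singleton]
    grind
  rw [← Finset.sum_filter, sum_const, nsmul_eq_mul, h, card_univ_sdiff, Fintype.card_fin,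
    card_pair hab, Nat.cast_sub hN, if_pos hab]
  norm_num

theorem card_distinctTriples_fin (hN : 2 ≤ N) :
    ((distinctTriples (Fin N)).card : ℝ) = N * (N - 1) * (N - 2) := by
  have h := distinctTriples_sum_pair hN fun _ _ => 1
  rw [sum_const, nsmul_eq_mul, mul_one] at h
  rw [h]
  have h1 : ∀ a : Fin N, ∑ b, (if a ≠ b then (1 : ℝ) else 0) = N - 1 := by
    intro a
    have h2 : (univ.filter fun b : Fin N => a ≠ b) = univ \ {a} := by
      ext c
      simp only [mem_filter, mem_univ, true_and, Finset.mem_sdiff, mem_singleton]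
      exact ne_comm
    rw [← Finset.sum_filter, sum_const, nsmul_eq_mul, h2, card_univ_sdiff, Fintype.card_fin,
      card_singleton, Nat.cast_sub (by omega)]
    norm_num
  simp only [h1, sum_const, card_univ, Fintype.card_fin, nsmul_eq_mul]
  ring

/-- Edges are cherries with a trivial second kernel, so the variance bound for cherries also covers
the edge count. -/
theorem cherryCount_one (hN : 2 ≤ N) {i : ℕ} (hi : 1 ≤ i) (x : Fin N → Cube n) :
    cherryCount (distKernel n {i}) (fun _ _ => 1) x =
      ((N : ℝ) - 2) * edgeSum (distKernel n {i}) x := by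
  simp only [cherryCount, cherry, mul_one, edgeSum]
  rw [distinctTriples_sum_pair hN fun a b => distKernel n {i} (x a) (x b)]
  congr 1
  refine Finset.sum_congr rfl fun a _ => Finset.sum_congr rfl fun b _ => ?_
  by_cases hab : a = b
  · simp [hab, distKernel_self hi]
  · simp [hab]

theorem typicalAt_of_deviations {d₀ i : ℕ} {x : Fin N → Cube n} {M : ℝ} (hN : 64 ≤ N) (hi0 : 0 < i)
    (hM : M ≤ (N : ℝ) ^ 3) (hq : N * sphereDensity n (range d₀) ≤ 1 / 16)
    (h1 : |cherryCount (distKernel n {i}) (fun _ _ => 1) x -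
      N * (N - 1) * (N - 2) * (sphereDensity n {i} * 1)| ≤ (N : ℝ) ^ 3 * sphereDensity n {i} / 32)
    (h2 : |cherryCount (distKernel n {i}) (distKernel n (range d₀)) x -
      M * (sphereDensity n {i} * sphereDensity n (range d₀))| ≤
        (N : ℝ) ^ 2 * sphereDensity n {i} / 16)
    (h3 : |cherryCount (distKernel n {i}) (distKernel n {i}) x -
      M * (sphereDensity n {i} * sphereDensity n {i})| ≤ (N : ℝ) ^ 3 * sphereDensity n {i} ^ 2)
    (h4 : squareCount (distKernel n {i}) x ≤ (N : ℝ) ^ 3 * sphereDensity n {i} ^ 2) :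
    TypicalAt d₀ i x := by
  have hp0 := (distKernel_regular n {i}).prob_nonneg
  have hq0 := (distKernel_regular n (range d₀)).prob_nonneg
  have hN' : (64 : ℝ) ≤ N := by exact_mod_cast hN
  rw [cherryCount_one (by omega) hi0] at h1
  obtain ⟨h1l, h1r⟩ := abs_le.1 h1
  replace h2 := (abs_le.1 h2).2
  replace h3 := (abs_le.1 h3).2
  have hN2 : (0 : ℝ) < N - 2 := by linarith
  generalize sphereDensity n (range d₀) = q at *
  constructor <;> generalize sphereDensity n {i} = p at *
  · clear h2 h3 h4
    refine le_of_mul_le_mul_left ?_ hN2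
    -- The bracket is (N−1)(N−2) − N²/32 − (7/8)N(N−2).
    have h : 0 ≤ (N : ℝ) * p * ((3 / 32) * N ^ 2 - (5 / 4) * N + 2) :=
      mul_nonneg (by positivity) (by nlinarith)
    linarith
  · clear h2 h3 h4
    refine le_of_mul_le_mul_left ?_ hN2
    have h : 0 ≤ (N : ℝ) * p * ((31 / 32) * N ^ 2 - N - 2) :=
      mul_nonneg (by positivity) (by nlinarith)
    linarith
  -- The mean and the allowed deviation each contribute 1/16 of N²p. The bound Nq ≤ 1/16 is where τ
  -- must be small.
  · have : M * (p * q) ≤ (N : ℝ) ^ 2 * p / 16 := by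
      calc M * (p * q) ≤ (N : ℝ) ^ 3 * (p * q) := mul_le_mul_of_nonneg_right hM (by positivity)
        _ = (N ^ 2 * p) * (N * q) := by ring
        _ ≤ (N ^ 2 * p) * (1 / 16) := mul_le_mul_of_nonneg_left hq (by positivity)
        _ = _ := by ring
    linarith
  · have : M * (p * p) ≤ (N : ℝ) ^ 3 * p ^ 2 := by
      rw [← pow_two]
      exact mul_le_mul_of_nonneg_right hM (by positivity)
    linarith
  · exact h4

/-- The three Chebyshev bounds, for edges, erased edges and cherries, are O(1/N) once Np ≥ c. The
constants sum to 55296 + 736 + 54 < 60000. -/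
theorem variance_ratio_le {N p q c : ℝ} (hN : 1 ≤ N) (hp : 0 < p) (hp1 : p ≤ 1) (hq0 : 0 ≤ q)
    (hq : N * q ≤ 1 / 16) (hc0 : 0 < c) (hc1 : c ≤ 1) (hc : c ≤ N * p) :
    N ^ 3 * (p * 1 * (27 + 18 * (N * p) + 9 * (N * 1))) / (N ^ 3 * p / 32) ^ 2 +
      N ^ 3 * (p * q * (27 + 18 * (N * p) + 9 * (N * q))) / (N ^ 2 * p / 16) ^ 2 +
      N ^ 3 * (p * p * (27 + 18 * (N * p) + 9 * (N * p))) / (N ^ 3 * p ^ 2) ^ 2 ≤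
      60000 / c ^ 2 / N := by
  have hNpos : 0 < N := by linarith
  have hinv : 1 / (N * p) ≤ 1 / c := one_div_le_one_div_of_le hc0 hc
  have hc2 : 1 / c ≤ 1 / c ^ 2 := one_div_le_one_div_of_le (by positivity) (by nlinarith)
  have hinv2 : 1 / (N * p) ≤ 1 / c ^ 2 := hinv.trans hc2
  have hc3 : 1 ≤ 1 / c ^ 2 := by
    rw [le_div_iff₀ (by positivity)]
    nlinarith
  have v1 : N ^ 3 * (p * 1 * (27 + 18 * (N * p) + 9 * (N * 1))) / (N ^ 3 * p / 32) ^ 2 ≤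
      55296 * (1 / c ^ 2) / N := by
    have h : 27 + 18 * (N * p) + 9 * (N * 1) ≤ 54 * N := by
      have : N * p ≤ N * 1 := mul_le_mul_of_nonneg_left hp1 hNpos.le
      linarith
    calc _ ≤ N ^ 3 * (p * 1 * (54 * N)) / (N ^ 3 * p / 32) ^ 2 := by gcongr
      _ = 55296 * (1 / (N * p)) / N := by field_simp; ring
      _ ≤ 55296 * (1 / c ^ 2) / N := by gcongr
  have v2 : N ^ 3 * (p * q * (27 + 18 * (N * p) + 9 * (N * q))) / (N ^ 2 * p / 16) ^ 2 ≤
      736 * (1 / c ^ 2) / N := by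
    have h : 27 + 18 * (N * p) + 9 * (N * q) ≤ 28 + 18 * (N * p) := by linarith
    calc _ = N ^ 2 * p * ((N * q) * (27 + 18 * (N * p) + 9 * (N * q))) /
          (N ^ 2 * p / 16) ^ 2 := by ring
      _ ≤ N ^ 2 * p * (1 / 16 * (28 + 18 * (N * p))) / (N ^ 2 * p / 16) ^ 2 := by gcongr
      _ = (448 * (1 / (N * p)) + 288 * 1) / N := by field_simp; ring
      _ ≤ (448 * (1 / c ^ 2) + 288 * (1 / c ^ 2)) / N := by gcongr
      _ = _ := by ring
  have v3 : N ^ 3 * (p * p * (27 + 18 * (N * p) + 9 * (N * p))) / (N ^ 3 * p ^ 2) ^ 2 ≤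
      54 * (1 / c ^ 2) / N := by
    calc _ = (27 * (1 / (N * p)) ^ 2 + 27 * (1 / (N * p))) / N := by field_simp; ring
      _ ≤ (27 * (1 / c) ^ 2 + 27 * (1 / c ^ 2)) / N := by gcongr
      _ = _ := by ring
  have h : 0 ≤ 1 / c ^ 2 / N := by positivity
  refine (add_le_add (add_le_add v1 v2) v3).trans ?_
  rw [show 60000 / c ^ 2 / N = 55296 * (1 / c ^ 2) / N + 736 * (1 / c ^ 2) / N +
    54 * (1 / c ^ 2) / N + 3914 * (1 / c ^ 2 / N) by ring]
  linarith

open Classical in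
theorem card_not_typicalAt_le {d₀ i : ℕ} {c ρ t : ℝ} (hN : 64 ≤ N) (hi0 : 0 < i) (hin : i < n)
    (hc0 : 0 < c) (hc1 : c ≤ 1) (hc : c ≤ N * sphereDensity n {i})
    (hq : N * sphereDensity n (range d₀) ≤ 1 / 16)
    (ht : 0 < t) (hρ : 0 < ρ) (ht4 : t ^ 4 = ((i : ℝ) / (n - i)) ^ 3)
    (hle : 1 + 6 * t ^ 2 + t ^ 4 ≤ ρ * (1 + (i : ℝ) / (n - i)) ^ 3) :
    ((univ.filter fun x : Fin N → Cube n => ¬ TypicalAt d₀ i x).card : ℝ) ≤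
      (60000 / c ^ 2 / N + N * sphereDensity n {i} * (ρ ^ n * ((n : ℝ) + 1) ^ 3)) *
        Fintype.card (Fin N → Cube n) := by
  have hu := distKernel_regular n {i}
  have hw := distKernel_regular n (range d₀)
  have hN' : (64 : ℝ) ≤ N := by exact_mod_cast hN
  have hp0 := hu.prob_nonneg
  have hp1 : sphereDensity n {i} ≤ 1 := by
    rw [← hu.row (fun _ => false)]
    exact Finset.expect_le univ_nonempty fun y _ => hu.le_one _ y
  have hNpos : (0 : ℝ) < N := by linarith
  have hppos : 0 < sphereDensity n {i} := by
    rcases hp0.lt_or_eq with h | h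
    · exact h
    · rw [← h] at hc; linarith
  have hsq := expect_squareCount_le (ι := Fin N) (distKernel n {i}) (by positivity)
    (expect_square_le_density hi0 hin ht hρ ht4 hle)
  have hV1 := expect_cherryCount_sub_sq_le (ι := Fin N) hu (one_regularKernel (X := Cube n))
  have hV2 := expect_cherryCount_sub_sq_le (ι := Fin N) hu hw
  have hV3 := expect_cherryCount_sub_sq_le (ι := Fin N) hu hu
  have hM := card_distinctTriples_le (ι := Fin N)
  rw [card_distinctTriples_fin (by omega)] at hV1
  rw [Fintype.card_fin] at hsq hV1 hV2 hV3 hM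
  have b1 := card_filter_le_of_expect_sq_le (s := (N : ℝ) ^ 3 * sphereDensity n {i} / 32)
    (by positivity) hV1
  have b2 := card_filter_le_of_expect_sq_le (s := (N : ℝ) ^ 2 * sphereDensity n {i} / 16)
    (by positivity) hV2
  have b3 := card_filter_le_of_expect_sq_le (s := (N : ℝ) ^ 3 * sphereDensity n {i} ^ 2)
    (by positivity) hV3
  have hsq0 : ∀ x : Fin N → Cube n, 0 ≤ squareCount (distKernel n {i}) x := fun x =>
    Finset.sum_nonneg fun t _ => mul_nonneg (mul_nonneg (mul_nonneg (hu.nonneg _ _)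
      (hu.nonneg _ _)) (hu.nonneg _ _)) (hu.nonneg _ _)
  have b4 := card_filter_le_of_expect_le (s := (N : ℝ) ^ 3 * sphereDensity n {i} ^ 2) hsq0
    (by positivity) hsq
  have v4 : (N : ℝ) ^ 4 * (ρ ^ n * ((n : ℝ) + 1) ^ 3 * sphereDensity n {i} ^ 3) /
      (N ^ 3 * sphereDensity n {i} ^ 2) =
      N * sphereDensity n {i} * (ρ ^ n * ((n : ℝ) + 1) ^ 3) := by
    field_simp
  rw [v4] at b4
  have hcard : ∀ {A1 A2 A3 A4 : Finset (Fin N → Cube n)},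
      (univ.filter fun x : Fin N → Cube n => ¬ TypicalAt d₀ i x) ⊆ A1 ∪ (A2 ∪ (A3 ∪ A4)) →
      ((univ.filter fun x : Fin N → Cube n => ¬ TypicalAt d₀ i x).card : ℝ) ≤
      A1.card + (A2.card + (A3.card + A4.card)) := by
    intro A1 A2 A3 A4 hsub
    have h := (Finset.card_le_card hsub).trans ((Finset.card_union_le _ _).trans
      (Nat.add_le_add_left ((Finset.card_union_le _ _).trans
        (Nat.add_le_add_left (Finset.card_union_le _ _) _)) _))
    exact_mod_cast h
  refine (hcard fun x hx => ?_).trans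
    ((add_le_add b1 (add_le_add b2 (add_le_add b3 b4))).trans ?_)
  · by_contra hcon
    simp only [mem_union, not_or, mem_filter, mem_univ, true_and, not_lt] at hcon
    exact (mem_filter.1 hx).2
      (typicalAt_of_deviations hN hi0 hM hq hcon.1 hcon.2.1 hcon.2.2.1 hcon.2.2.2)
  · have hv := variance_ratio_le (by linarith) hppos hp1 hw.prob_nonneg hq hc0 hc1 hc
    rw [← add_mul, ← add_mul, ← add_mul]
    refine mul_le_mul_of_nonneg_right ?_ (by positivity)
    linarith

end Concentration

/-! ### Consequences of typical counts for the code -/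

section Typical

variable {n N : ℕ}

theorem le_hammingDist_of_mem_erase {d₀ : ℕ} {x : Fin N → Cube n} {y z : Cube n}
    (hy : y ∈ erase d₀ x) (hz : z ∈ erase d₀ x) (hyz : y ≠ z) : d₀ ≤ hammingDist y z := by
  rw [erase_eq, mem_image] at hy hz
  obtain ⟨a, ha, rfl⟩ := hy
  obtain ⟨b, _, rfl⟩ := hz
  exact mem_survivors.1 ha b fun h => hyz (by rw [h])

theorem TypicalAt.sum_survivors_ge {d₀ i : ℕ} {x : Fin N → Cube n} (h : TypicalAt d₀ i x)
    (hi : 1 ≤ i) (hdi : d₀ ≤ i) : 1 / 2 * ((N : ℝ) ^ 2 * sphereDensity n {i}) ≤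
      ∑ a ∈ survivors d₀ x, ∑ b ∈ survivors d₀ x, distKernel n {i} (x a) (x b) := by
  have h1 := le_sum_survivors hi hdi x
  have h2 := h.edge_ge
  have h3 := h.erased_le
  have hp := (distKernel_regular n {i}).prob_nonneg
  have : 0 ≤ (N : ℝ) ^ 2 * sphereDensity n {i} := by positivity
  linarith

/-- Erasure leaves no two codewords closer than `d₀`, and positivity of the surviving edge count
provides a pair at distance exactly `d₀`. -/
theorem TypicalAt.nontrivial_and_minDist {d₀ : ℕ} {x : Fin N → Cube n} (h : TypicalAt d₀ d₀ x)
    (hd : 1 ≤ d₀) (hp : 0 < (N : ℝ) ^ 2 * sphereDensity n {d₀}) :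
    (erase d₀ x).Nontrivial ∧ minDist (erase d₀ x) = d₀ := by
  have h1 := h.sum_survivors_ge hd le_rfl
  have hpos : 0 < ∑ a ∈ survivors d₀ x, ∑ b ∈ survivors d₀ x, distKernel n {d₀} (x a) (x b) := by
    linarith
  obtain ⟨a, ha, hpos⟩ := Finset.exists_ne_zero_of_sum_ne_zero hpos.ne'
  obtain ⟨b, hb, hpos⟩ := Finset.exists_ne_zero_of_sum_ne_zero hpos
  have hab : hammingDist (x a) (x b) = d₀ := by
    by_contra hne
    simp [distKernel, hne] at hpos
  have hne : x a ≠ x b := by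
    intro hab'
    rw [hab', hammingDist_self] at hab
    omega
  have hxa : x a ∈ erase d₀ x := by rw [erase_eq]; exact mem_image_of_mem x ha
  have hxb : x b ∈ erase d₀ x := by rw [erase_eq]; exact mem_image_of_mem x hb
  refine ⟨⟨x a, hxa, x b, hxb, hne⟩, ?_⟩
  have hmem : d₀ ∈ {k : ℕ | ∃ y ∈ erase d₀ x, ∃ z ∈ erase d₀ x, y ≠ z ∧ hammingDist y z = k} :=
    ⟨x a, hxa, x b, hxb, hne, hab⟩
  refine le_antisymm (Nat.sInf_le hmem) (le_csInf ⟨_, hmem⟩ ?_)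
  rintro k ⟨y, hy, z, hz, hyz, rfl⟩
  exact le_hammingDist_of_mem_erase hy hz hyz

theorem TypicalAt.uniformNorm_div_le {d₀ i : ℕ} {x : Fin N → Cube n} (h : TypicalAt d₀ i x)
    (hd : 1 ≤ d₀) (hdi : d₀ ≤ i) {c : ℝ} (hc0 : 0 < c) (hc : c ≤ N * sphereDensity n {i}) :
    eigenvalueVector (erase d₀ x) i ≠ 0 ∧
      uniformNorm 4 (eigenvalueVector (erase d₀ x) i) /
        uniformNorm 2 (eigenvalueVector (erase d₀ x) i) ≤ 4 * (5 + 4 / c) := by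
  have hi : 1 ≤ i := hd.trans hdi
  have h2 := h.sum_survivors_ge hi hdi
  rw [← sum_eigenvalueVector_sq hd hi] at h2
  have h4 := sum_eigenvalueVector_pow_four_le hd hi x
  have e1 := h.edge_le
  have e2 := h.cherry_le
  have e3 := h.square_le
  set p := sphereDensity n {i}
  have hμ : 0 < (N : ℝ) * p := lt_of_lt_of_le hc0 hc
  have hN0 : (0 : ℝ) ≤ N := by positivity
  have hN : (0 : ℝ) < N := by
    rcases hN0.lt_or_eq with h | h
    · exact h
    · rw [← h] at hμ; simp at hμ
  have hp : 0 < p := pos_of_mul_pos_right hμ hN0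
  have hcard : (Fintype.card (erase d₀ x) : ℝ) ≤ N := by
    rw [Fintype.card_coe, erase_eq]
    have := (Finset.card_image_le (s := survivors d₀ x) (f := x)).trans (Finset.card_le_univ _)
    rw [Fintype.card_fin] at this
    exact_mod_cast this
  have hdiv : 0 ≤ 4 / c := by positivity
  refine RandomCode.uniformNorm_div_le (by linarith) hcard
    (lt_of_lt_of_le (by positivity) h2) ?_
  -- 4N²p is twice the edge bound and 5 = 2·2 + 1 comes from cherries and four-cycles; Np ≥ c
  -- absorbs the first into the second.
  have hup : ∑ j, eigenvalueVector (erase d₀ x) i j ^ 4 ≤ (5 + 4 / c) * (N ^ 3 * p ^ 2) := by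
    have : 4 * ((N : ℝ) ^ 2 * p) ≤ 4 / c * (N ^ 3 * p ^ 2) := by
      rw [div_mul_eq_mul_div, le_div_iff₀ hc0]
      calc 4 * ((N : ℝ) ^ 2 * p) * c ≤ 4 * ((N : ℝ) ^ 2 * p) * (N * p) := by gcongr
        _ = _ := by ring
    linarith
  calc (N : ℝ) * ∑ j, eigenvalueVector (erase d₀ x) i j ^ 4 ≤
        N * ((5 + 4 / c) * (N ^ 3 * p ^ 2)) := by gcongr
    _ = 4 * (5 + 4 / c) * (1 / 2 * ((N : ℝ) ^ 2 * p)) ^ 2 := by ring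
    _ ≤ _ := by gcongr

end Typical

/-! ### Asymptotics of the erasure threshold and of the mean degree -/

section Asymptotics

theorem tendsto_succ_pow_mul_pow (k : ℕ) {r : ℝ} (h0 : 0 < r) (h1 : r < 1) :
    Tendsto (fun n : ℕ => ((n : ℝ) + 1) ^ k * r ^ n) atTop (𝓝 0) := by
  have h := (tendsto_pow_const_mul_const_pow_of_abs_lt_one k (r := r)
    (by rwa [abs_of_pos h0])).comp (tendsto_add_atTop_nat 1)
  have h2 := h.const_mul r⁻¹
  rw [mul_zero] at h2
  refine h2.congr fun n => ?_
  simp only [Function.comp]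
  push_cast
  rw [pow_succ r n]
  field_simp

theorem exists_rpow_le {A b : ℝ} (hA : 1 < A) (hb : 1 < b) : ∃ ε : ℝ, 0 < ε ∧ A ^ ε ≤ b := by
  have hlA := Real.log_pos hA
  have hlb := Real.log_pos hb
  refine ⟨Real.log b / Real.log A, by positivity, ?_⟩
  rw [Real.rpow_def_of_pos (by linarith), mul_div_cancel₀ _ hlA.ne', Real.exp_log (by linarith)]

variable {R τ : ℝ}

theorem prescribedCard_le (R : ℝ) (n : ℕ) : (prescribedCard R n : ℝ) ≤ ((2 : ℝ) ^ R) ^ n := by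
  rw [← Real.rpow_mul_natCast (by norm_num)]
  exact Nat.floor_le (by positivity)

theorem le_two_mul_prescribedCard (hR : 0 ≤ R) (n : ℕ) :
    ((2 : ℝ) ^ R) ^ n ≤ 2 * prescribedCard R n := by
  rw [← Real.rpow_mul_natCast (by norm_num)]
  have h1 : (2 : ℝ) ^ (R * (n : ℝ)) < prescribedCard R n + 1 := Nat.lt_floor_add_one _
  have h2 : 1 ≤ prescribedCard R n := by
    refine Nat.le_floor ?_
    push_cast
    exact Real.one_le_rpow (by norm_num) (by positivity)
  have h3 : (1 : ℝ) ≤ prescribedCard R n := by exact_mod_cast h2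
  linarith

/-- The cap k ≤ N in the definition of the threshold is then harmless for k ≤ n, and N ≥ 64 serves
the concentration bounds. -/
theorem eventually_add_le_prescribedCard (hR : 0 < R) :
    ∀ᶠ n : ℕ in atTop, n + 64 ≤ prescribedCard R n := by
  have hg : 1 < (2 : ℝ) ^ R := Real.one_lt_rpow (by norm_num) hR
  have h := tendsto_succ_pow_mul_pow 1 (r := ((2 : ℝ) ^ R)⁻¹) (by positivity) (inv_lt_one_of_one_lt₀ hg)
  filter_upwards [h.eventually (gt_mem_nhds (show (0 : ℝ) < 1 / 128 by norm_num))] with n hn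
  have h1 := le_two_mul_prescribedCard hR.le n
  rw [inv_pow, pow_one, ← div_eq_mul_inv, div_lt_iff₀ (by positivity)] at hn
  have h2 : (n : ℝ) + 64 ≤ prescribedCard R n := by
    have : (0 : ℝ) ≤ n := by positivity
    linarith
  exact_mod_cast h2

theorem threshold_spec {n : ℕ} (h : threshold R τ n ≠ 0) :
    prescribedCard R n * sphereDensity n (range (threshold R τ n)) ≤ τ := by
  have := Nat.findGreatest_of_ne_zero (m := threshold R τ n) rfl h
  rw [sphereDensity, mul_div_assoc', mul_div_right_comm]
  exact this

theorem le_threshold {n k : ℕ} (hk : k ≤ prescribedCard R n)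
    (h : prescribedCard R n * sphereDensity n (range k) ≤ τ) : k ≤ threshold R τ n := by
  rw [sphereDensity, mul_div_assoc', mul_div_right_comm] at h
  exact Nat.le_findGreatest hk h

/-- A ball of radius αn is exponentially smaller than 2ⁿ/N for small α. The order of quantifiers
matters: α does not depend on τ, so neither will ε₀. -/
theorem exists_mul_le_threshold (hR0 : 0 < R) (hR1 : R < 1) : ∃ α : ℝ, 0 < α ∧ α ≤ 1 / 4 ∧
    ∀ τ : ℝ, 0 < τ → ∀ᶠ n : ℕ in atTop, α * n ≤ threshold R τ n := by
  set g : ℝ := (2 : ℝ) ^ R with hg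
  have hg0 : 0 < g := by positivity
  have hg2 : g < 2 := by
    calc g < 2 ^ (1 : ℝ) := Real.rpow_lt_rpow_of_exponent_lt (by norm_num) hR1
      _ = 2 := Real.rpow_one 2
  have hb4 : 1 < 2 / g := by rwa [one_lt_div hg0]
  -- The ratio 2/g = b⁴ is spent as follows: (1+y)ⁿ costs bⁿ, y⁻ᵏ costs bⁿ up to a constant, and
  -- b⁻²ⁿ remains to beat τ.
  set b : ℝ := √(√(2 / g)) with hb
  have hb1 : 1 < b := by
    rw [hb, Real.lt_sqrt (by norm_num), Real.lt_sqrt (by norm_num)]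
    simpa using hb4
  have hbpow : b ^ 4 = 2 / g := by
    rw [show 4 = 2 * 2 by norm_num, pow_mul, hb, Real.sq_sqrt (Real.sqrt_nonneg _),
      Real.sq_sqrt (by positivity)]
  have hb0 : 0 < b := by linarith
  set y : ℝ := (b - 1) / b with hy
  have hy0 : 0 < y := div_pos (by linarith) hb0
  have hy1 : y < 1 := by rw [hy, div_lt_one hb0]; linarith
  have hyb : 1 + y ≤ b := by
    have : y * b = b - 1 := div_mul_cancel₀ _ hb0.ne'
    refine le_of_mul_le_mul_right ?_ hb0
    nlinarith [sq_nonneg (b - 1)]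
  have hy1' : 1 < 1 / y := by rwa [one_lt_div hy0]
  obtain ⟨ε, hε, hεb⟩ := exists_rpow_le hy1' hb1
  refine ⟨min ε (1 / 4), by positivity, min_le_right _ _, fun τ hτ => ?_⟩
  set α := min ε (1 / 4) with hα
  have hα0 : 0 < α := by positivity
  have hα4 : α ≤ 1 / 4 := min_le_right _ _
  have hαb : (1 / y) ^ α ≤ b :=
    (Real.rpow_le_rpow_of_exponent_le hy1'.le (min_le_left _ _)).trans hεb
  have hlim := tendsto_succ_pow_mul_pow 0 (r := (b ^ 2)⁻¹) (by positivity)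
    (inv_lt_one_of_one_lt₀ (by nlinarith))
  filter_upwards [hlim.eventually (gt_mem_nhds (show 0 < τ * y by positivity)),
    eventually_add_le_prescribedCard hR0, eventually_ge_atTop 2] with n hn hN hn2
  refine (Nat.le_ceil (α * n)).trans ?_
  have hn2' : (2 : ℝ) ≤ n := by exact_mod_cast hn2
  have hceil : (⌈α * (n : ℝ)⌉₊ : ℝ) < α * n + 1 := Nat.ceil_lt_add_one (by positivity)
  have hkn : ⌈α * (n : ℝ)⌉₊ ≤ n := by
    refine Nat.ceil_le.2 ?_
    nlinarith
  set k := ⌈α * (n : ℝ)⌉₊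
  have hk : k ≤ threshold R τ n := by
    refine le_threshold (by omega) ?_
    have h1 := sum_choose_mul_pow_le n k hy0 hy1.le hkn
    rw [sphereDensity]
    set V : ℝ := ∑ l ∈ range k, (n.choose l : ℝ)
    have hyk : (1 / y) ^ k ≤ b ^ n / y := by
      calc (1 / y) ^ k = (1 / y) ^ (k : ℝ) := (Real.rpow_natCast _ _).symm
        _ ≤ (1 / y) ^ (α * n + 1) := Real.rpow_le_rpow_of_exponent_le hy1'.le hceil.le
        _ = ((1 / y) ^ α) ^ n / y := by
          rw [Real.rpow_add (by positivity), Real.rpow_one, Real.rpow_mul_natCast (by positivity)]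
          ring
        _ ≤ b ^ n / y := by gcongr
    have hV : V ≤ b ^ n * (b ^ n / y) := by
      calc V = V * y ^ k * (1 / y) ^ k := by
            rw [mul_assoc, ← mul_pow, mul_one_div_cancel hy0.ne', one_pow, mul_one]
        _ ≤ (1 + y) ^ n * (1 / y) ^ k := by gcongr
        _ ≤ b ^ n * (b ^ n / y) := by gcongr
    rw [pow_zero, one_mul] at hn
    have hid : g ^ n * (b ^ n * (b ^ n / y) / 2 ^ n) = ((b ^ 2)⁻¹) ^ n / y := by
      have : g * (b * b) / 2 = (b ^ 2)⁻¹ := by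
        have h2 : g * b ^ 4 = 2 := by rw [hbpow]; field_simp
        field_simp
        linarith
      rw [← this, div_pow, mul_pow, mul_pow]
      ring
    calc (prescribedCard R n : ℝ) * (V / 2 ^ n) ≤ g ^ n * (b ^ n * (b ^ n / y) / 2 ^ n) := by
          gcongr
          exact prescribedCard_le R n
      _ = ((b ^ 2)⁻¹) ^ n / y := hid
      _ ≤ τ := by rw [div_le_iff₀ hy0]; exact hn.le
  exact_mod_cast hk

/-- Otherwise the sum defining the threshold would contain C(n,k) with k = ⌊(1/2 − R/4)n⌋, which is
at least 2ⁿ·3^(−Rn/4) up to a polynomial. As 3^(R/4) < 2^R, multiplying by N/2ⁿ exceeds τ. -/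
theorem eventually_threshold_le (hR0 : 0 < R) (hR1 : R < 1) (τ : ℝ) (hτ : 0 < τ) :
    ∀ᶠ n : ℕ in atTop, (threshold R τ n : ℝ) ≤ (1 / 2 - R / 4) * n := by
  set g : ℝ := (2 : ℝ) ^ R with hg
  set h : ℝ := (3 : ℝ) ^ (R / 4) with hh
  have hg0 : 0 < g := by positivity
  have hh0 : 0 < h := by positivity
  have hhg : h < g := by
    calc h < 16 ^ (R / 4) := Real.rpow_lt_rpow (by norm_num) (by norm_num) (by positivity)
      _ = ((2 : ℝ) ^ (4 : ℝ)) ^ (R / 4) := by norm_num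
      _ = g := by rw [← Real.rpow_mul (by norm_num)]; congr 1; ring
  have hlim := tendsto_succ_pow_mul_pow 1 (r := h / g) (by positivity) (by rwa [div_lt_one hg0])
  filter_upwards [hlim.eventually (gt_mem_nhds (show 0 < 1 / (6 * τ) by positivity))] with n hn
  by_contra! hcon
  have hβ0 : 0 ≤ (1 / 2 - R / 4) * (n : ℝ) := mul_nonneg (by linarith) (by positivity)
  have hfl : (⌊(1 / 2 - R / 4) * (n : ℝ)⌋₊ : ℝ) ≤ (1 / 2 - R / 4) * n := Nat.floor_le hβ0
  have hfl2 : (1 / 2 - R / 4) * (n : ℝ) < ⌊(1 / 2 - R / 4) * (n : ℝ)⌋₊ + 1 := Nat.lt_floor_add_one _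
  set k := ⌊(1 / 2 - R / 4) * (n : ℝ)⌋₊
  have hn0 : (0 : ℝ) ≤ n := by positivity
  have hkd : k < threshold R τ n := by exact_mod_cast hfl.trans_lt hcon
  have hk4 : n ≤ 4 * k + 3 := by
    have : (n : ℝ) < 4 * k + 4 := by nlinarith
    have : n < 4 * k + 4 := by exact_mod_cast this
    omega
  have hk2 : k ≤ n / 2 := by
    have : 2 * (k : ℝ) ≤ n := by nlinarith
    have : 2 * k ≤ n := by exact_mod_cast this
    omega
  have h1 := two_pow_le_choose (n := n) (n / 2 - k) k (by omega) hk4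
  have h2 := threshold_spec (R := R) (τ := τ) (n := n) (by omega)
  have h3 : (n.choose k : ℝ) ≤ ∑ l ∈ range (threshold R τ n), (n.choose l : ℝ) :=
    Finset.single_le_sum (f := fun l => (n.choose l : ℝ)) (fun l _ => by positivity)
      (mem_range.2 hkd)
  have hm : ((n / 2 - k : ℕ) : ℝ) ≤ R / 4 * n + 1 := by
    rw [Nat.cast_sub hk2]
    have : ((n / 2 : ℕ) : ℝ) ≤ (n : ℝ) / 2 := Nat.cast_div_le
    linarith
  have h3m : (3 : ℝ) ^ (n / 2 - k) ≤ h ^ n * 3 := by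
    calc (3 : ℝ) ^ (n / 2 - k) = (3 : ℝ) ^ ((n / 2 - k : ℕ) : ℝ) := (Real.rpow_natCast _ _).symm
      _ ≤ 3 ^ (R / 4 * n + 1) := Real.rpow_le_rpow_of_exponent_le (by norm_num) hm
      _ = h ^ n * 3 := by
        rw [Real.rpow_add (by norm_num), Real.rpow_one, Real.rpow_mul_natCast (by norm_num)]
  have h4 := le_two_mul_prescribedCard hR0.le n
  have hN0 : (0 : ℝ) ≤ prescribedCard R n := by positivity
  rw [sphereDensity, mul_div_assoc', div_le_iff₀ (by positivity)] at h2
  set N : ℝ := (prescribedCard R n : ℝ)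
  have hCpos : (0 : ℝ) < n.choose k := by
    exact_mod_cast Nat.choose_pos (by omega)
  have h5 : N * n.choose k ≤ τ * (((n : ℝ) + 1) * (h ^ n * 3)) * n.choose k := by
    calc N * n.choose k ≤ τ * 2 ^ n := (mul_le_mul_of_nonneg_left h3 hN0).trans h2
      _ ≤ τ * ((n + 1) * 3 ^ (n / 2 - k) * n.choose k) := by gcongr
      _ ≤ τ * ((n + 1) * (h ^ n * 3) * n.choose k) := by gcongr
      _ = _ := by ring
  have h6 := le_of_mul_le_mul_right h5 hCpos
  rw [pow_one, div_pow, lt_div_iff₀ (by positivity), mul_div_assoc', div_mul_eq_mul_div,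
    div_lt_one (by positivity)] at hn
  have h7 : g ^ n ≤ 2 * N := h4
  linarith

theorem le_mul_sphereDensity_threshold (hR0 : 0 < R) {n : ℕ}
    (hd : (threshold R τ n : ℝ) ≤ (1 / 2 - R / 4) * n) (hR1 : R < 1)
    (hN : n + 64 ≤ prescribedCard R n) :
    τ * (2 * R / (2 + R)) ≤ prescribedCard R n * sphereDensity n {threshold R τ n} := by
  have hdn : threshold R τ n ≤ n := by
    have : (threshold R τ n : ℝ) ≤ n := by
      have : (0 : ℝ) ≤ n := by positivity
      nlinarith
    exact_mod_cast this
  -- Maximality of the threshold: d₀ + 1 is still an admissible candidate because d₀ ≤ n < N.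
  have h1 : τ < prescribedCard R n * sphereDensity n (range (threshold R τ n + 1)) := by
    by_contra! hcon
    have := le_threshold (by omega) hcon
    omega
  have h2 := sum_choose_le (n := n) (β := 1 / 2 - R / 4) (by linarith) (by linarith) _ hd
  rw [show (1 - (1 / 2 - R / 4)) / (1 - 2 * (1 / 2 - R / 4)) = (2 + R) / (2 * R) by
    field_simp; ring] at h2
  rw [sphereDensity] at h1
  rw [sphereDensity_singleton]
  have h3 : τ ≤ (prescribedCard R n * (n.choose (threshold R τ n) / 2 ^ n)) * ((2 + R) / (2 * R)) := by
    refine h1.le.trans ?_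
    calc _ ≤ (prescribedCard R n : ℝ) * (((2 + R) / (2 * R) * n.choose (threshold R τ n)) / 2 ^ n) := by
          gcongr
      _ = _ := by ring
  calc τ * (2 * R / (2 + R)) ≤ (prescribedCard R n * (n.choose (threshold R τ n) / 2 ^ n)) *
        ((2 + R) / (2 * R)) * (2 * R / (2 + R)) := by gcongr
    _ = _ := by field_simp

theorem sphereDensity_singleton_mono {n d i : ℕ} (hdi : d ≤ i) (hi : 2 * i ≤ n) :
    sphereDensity n {d} ≤ sphereDensity n {i} := by
  rw [sphereDensity_singleton, sphereDensity_singleton]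
  have h := choose_le_choose_of_le_half (n := n) (k := d) (i - d) (by omega)
  rw [show d + (i - d) = i by omega] at h
  gcongr

/-- Consecutive binomial coefficients from index d₀ − 1 on grow by at most 1/α. The start is d₀ − 1,
the last radius controlled by τ, hence the extra 1 in the exponent. -/
theorem mul_sphereDensity_le {n i : ℕ} {α : ℝ} (hα : 0 < α) (hτ1 : τ ≤ 1)
    (hd : 1 ≤ threshold R τ n) (hαd : α * n ≤ threshold R τ n) (hdi : threshold R τ n ≤ i)
    (hin : i ≤ n) :
    prescribedCard R n * sphereDensity n {i} ≤ (1 / α) ^ (i - threshold R τ n + 1) := by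
  have h2 := threshold_spec (R := R) (τ := τ) (n := n) (by omega)
  set d := threshold R τ n
  have h3 : (n.choose (d - 1) : ℝ) ≤ ∑ l ∈ range d, (n.choose l : ℝ) :=
    Finset.single_le_sum (f := fun l => (n.choose l : ℝ)) (fun l _ => by positivity)
      (mem_range.2 (by omega))
  have hd1 : ((d - 1 : ℕ) : ℝ) + 1 = d := by
    have : d - 1 + 1 = d := by omega
    exact_mod_cast this
  have h4 := choose_add_le (n := n) (k := d - 1) hα (by rw [hd1]; exact hαd) (i - d + 1) (by omega)
  rw [show d - 1 + (i - d + 1) = i by omega] at h4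
  rw [sphereDensity_singleton]
  rw [sphereDensity] at h2
  calc (prescribedCard R n : ℝ) * (n.choose i / 2 ^ n) ≤
        prescribedCard R n * ((n.choose (d - 1) * (1 / α) ^ (i - d + 1)) / 2 ^ n) := by gcongr
    _ ≤ prescribedCard R n * (((∑ l ∈ range d, (n.choose l : ℝ)) * (1 / α) ^ (i - d + 1)) / 2 ^ n) := by
        gcongr
    _ = (prescribedCard R n * ((∑ l ∈ range d, (n.choose l : ℝ)) / 2 ^ n)) * (1 / α) ^ (i - d + 1) := by
        ring
    _ ≤ 1 * (1 / α) ^ (i - d + 1) := by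
        gcongr
        exact h2.trans hτ1
    _ = _ := one_mul _

end Asymptotics

/-! ### Choice of constants and union bound over the distances -/

section Main

/-- The code has at least two points, and the spectra of its distance graphs near the minimal
distance have bounded norm ratio. -/
def SpectrallyBounded {n : ℕ} (ε₀ K : ℝ) (C : Finset (Cube n)) : Prop :=
  C.Nontrivial ∧ ∀ i : ℕ, minDist C ≤ i → (i : ℝ) ≤ (1 + ε₀) * (minDist C : ℝ) →
    eigenvalueVector C i ≠ 0 ∧
      uniformNorm 4 (eigenvalueVector C i) / uniformNorm 2 (eigenvalueVector C i) ≤ K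

theorem spectrallyBounded_of_typicalAt {n N d₀ : ℕ} {ε₀ c : ℝ} {x : Fin N → Cube n}
    (hε : 0 ≤ ε₀) (hd : 1 ≤ d₀) (hc0 : 0 < c)
    (hc : ∀ i : ℕ, d₀ ≤ i → (i : ℝ) ≤ (1 + ε₀) * d₀ → c ≤ N * sphereDensity n {i})
    (hx : ∀ i : ℕ, d₀ ≤ i → (i : ℝ) ≤ (1 + ε₀) * d₀ → TypicalAt d₀ i x) :
    SpectrallyBounded ε₀ (4 * (5 + 4 / c)) (erase d₀ x) := by
  have hd0 : (d₀ : ℝ) ≤ (1 + ε₀) * d₀ := le_mul_of_one_le_left (by positivity) (by linarith)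
  have hμ := hc d₀ le_rfl hd0
  have hpos : 0 < (N : ℝ) * sphereDensity n {d₀} := hc0.trans_le hμ
  have hp := (distKernel_regular n {d₀}).prob_nonneg
  have hN : (0 : ℝ) < N := pos_of_mul_pos_left hpos hp
  obtain ⟨h1, h2⟩ := (hx d₀ le_rfl hd0).nontrivial_and_minDist hd (by
    rw [pow_two, mul_assoc]; positivity)
  refine ⟨h1, fun i hi hi' => ?_⟩
  rw [h2] at hi hi'
  exact (hx i hi hi').uniformNorm_div_le hd hi hc0 (hc i hi hi')

open Classical in
theorem card_not_spectrallyBounded_le {n N d₀ : ℕ} {ε₀ c B : ℝ} (hε : 0 ≤ ε₀) (hd : 1 ≤ d₀)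
    (hc0 : 0 < c) (hdn : (1 + ε₀) * d₀ ≤ n) (hB0 : 0 ≤ B)
    (hc : ∀ i : ℕ, d₀ ≤ i → (i : ℝ) ≤ (1 + ε₀) * d₀ → c ≤ N * sphereDensity n {i})
    (hB : ∀ i : ℕ, d₀ ≤ i → (i : ℝ) ≤ (1 + ε₀) * d₀ →
      ((univ.filter fun x : Fin N → Cube n => ¬ TypicalAt d₀ i x).card : ℝ) ≤
        B * Fintype.card (Fin N → Cube n)) :
    ((univ.filter fun x : Fin N → Cube n =>
      ¬ SpectrallyBounded ε₀ (4 * (5 + 4 / c)) (erase d₀ x)).card : ℝ) ≤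
        ((n : ℝ) + 1) * B * Fintype.card (Fin N → Cube n) := by
  set S := (range (n + 1)).filter fun i : ℕ => d₀ ≤ i ∧ (i : ℝ) ≤ (1 + ε₀) * d₀ with hS
  have hsub : (univ.filter fun x : Fin N → Cube n =>
      ¬ SpectrallyBounded ε₀ (4 * (5 + 4 / c)) (erase d₀ x)) ⊆
      S.biUnion fun i => univ.filter fun x : Fin N → Cube n => ¬ TypicalAt d₀ i x := by
    intro x hx
    by_contra hcon
    refine (mem_filter.1 hx).2 (spectrallyBounded_of_typicalAt hε hd hc0 hc fun i hi hi' => ?_)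
    by_contra hty
    refine hcon (mem_biUnion.2 ⟨i, mem_filter.2 ⟨mem_range.2 ?_, hi, hi'⟩,
      mem_filter.2 ⟨mem_univ _, hty⟩⟩)
    have : (i : ℝ) ≤ n := hi'.trans hdn
    have : i ≤ n := by exact_mod_cast this
    omega
  have hcard : ((univ.filter fun x : Fin N → Cube n =>
      ¬ SpectrallyBounded ε₀ (4 * (5 + 4 / c)) (erase d₀ x)).card : ℝ) ≤
      ∑ i ∈ S, ((univ.filter fun x : Fin N → Cube n => ¬ TypicalAt d₀ i x).card : ℝ) := by
    exact_mod_cast (Finset.card_le_card hsub).trans Finset.card_biUnion_le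
  refine hcard.trans ((Finset.sum_le_card_nsmul _ _ _ fun i hi =>
    hB i (mem_filter.1 hi).2.1 (mem_filter.1 hi).2.2).trans ?_)
  rw [nsmul_eq_mul, mul_assoc]
  refine mul_le_mul_of_nonneg_right ?_ (by positivity)
  have : S.card ≤ n + 1 := (Finset.card_filter_le _ _).trans (by simp)
  exact_mod_cast this

/-- The bound `ε₀ ≤ R / 4` keeps i a fixed proportion below n/2, since (1+R/4)(1/2−R/4) ≤ 1/2 − R/8.
So y = i/(n−i) lies in a compact subinterval of (0,1) depending only on R, and a single ρ serves all
i. -/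
theorem ratio_bounds {n i d : ℕ} {α R ε₀ : ℝ} (hR0 : 0 < R) (hR1 : R < 1) (hn : 0 < n)
    (hε : ε₀ ≤ R / 4) (hα : 0 < α) (hαd : α * n ≤ d)
    (hd : (d : ℝ) ≤ (1 / 2 - R / 4) * n) (hdi : d ≤ i) (hi : (i : ℝ) ≤ (1 + ε₀) * d) :
    (i : ℝ) ≤ (1 / 2 - R / 8) * n ∧ α ≤ (i : ℝ) / (n - i) ∧
      (i : ℝ) / (n - i) ≤ (1 / 2 - R / 8) / (1 / 2 + R / 8) := by
  have hn' : (0 : ℝ) < n := by exact_mod_cast hn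
  have hdi' : (d : ℝ) ≤ i := by exact_mod_cast hdi
  have hi0 : (0 : ℝ) ≤ i := by positivity
  have h1 : (i : ℝ) ≤ (1 / 2 - R / 8) * n := by
    calc (i : ℝ) ≤ (1 + ε₀) * d := hi
      _ ≤ (1 + R / 4) * ((1 / 2 - R / 4) * n) := by gcongr
      _ = ((1 + R / 4) * (1 / 2 - R / 4)) * n := by ring
      _ ≤ _ := mul_le_mul_of_nonneg_right (by nlinarith) hn'.le
  have hni : (1 / 2 + R / 8) * n ≤ (n : ℝ) - i := by linarith
  have hni0 : (0 : ℝ) < (n : ℝ) - i := lt_of_lt_of_le (by positivity) hni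
  refine ⟨h1, ?_, ?_⟩
  · rw [le_div_iff₀ hni0]
    nlinarith
  · rw [div_le_div_iff₀ hni0 (by positivity)]
    have e1 : (i : ℝ) * (1 / 2 + R / 8) ≤ (1 / 2 - R / 8) * n * (1 / 2 + R / 8) := by gcongr
    have e2 : (1 / 2 - R / 8) * ((1 / 2 + R / 8) * n) ≤ (1 / 2 - R / 8) * ((n : ℝ) - i) :=
      mul_le_mul_of_nonneg_left hni (by linarith)
    linarith

theorem exists_tendsto_spectrallyBounded (R : ℝ) (hR0 : 0 < R) (hR1 : R < 1) :
    ∃ ε₀ : ℝ, 0 < ε₀ ∧ ∀ τ : ℝ, 0 < τ → τ ≤ 1 / 16 → ∃ K : ℝ, 0 < K ∧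
      Tendsto (fun n : ℕ => pointsLaw n (prescribedCard R n)
        {x | SpectrallyBounded ε₀ K (code R τ n x)}) atTop (𝓝 1) := by
  obtain ⟨α, hα0, hα4, hα⟩ := exists_mul_le_threshold hR0 hR1
  have hy1 : (1 / 2 - R / 8) / (1 / 2 + R / 8) < 1 := by
    rw [div_lt_one (by positivity)]; linarith
  have hαy : α ≤ (1 / 2 - R / 8) / (1 / 2 + R / 8) := by
    rw [le_div_iff₀ (by positivity)]; nlinarith
  obtain ⟨ρ, hρ0, hρ1, hρ⟩ := exists_square_base hα0 hy1 hαy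
  have hA : 1 < 1 / α := by rw [one_lt_div hα0]; linarith
  have hsρ0 : 0 < √ρ := Real.sqrt_pos.2 hρ0
  have hsρ1 : √ρ < 1 := by rw [Real.sqrt_lt' one_pos]; linarith
  have hsρ : √ρ * √ρ = ρ := Real.mul_self_sqrt hρ0.le
  obtain ⟨ε, hε0, hε⟩ := exists_rpow_le hA (b := 1 / √ρ) (by rwa [one_lt_div hsρ0])
  -- ε makes (1/α)^ε at most ρ^(-1/2), so half of the four-cycle gain survives the growth of Np; R/4
  -- keeps i below n/2.
  refine ⟨min ε (R / 4), by positivity, fun τ hτ0 hτ => ?_⟩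
  set ε₀ := min ε (R / 4) with hε₀def
  have hε₀ : 0 < ε₀ := by positivity
  have hε₀R : ε₀ ≤ R / 4 := min_le_right _ _
  have hεθ : (1 / α) ^ ε₀ * ρ ≤ √ρ := by
    calc (1 / α) ^ ε₀ * ρ ≤ 1 / √ρ * ρ := by
          gcongr
          exact (Real.rpow_le_rpow_of_exponent_le hA.le (min_le_left _ _)).trans hε
      _ = 1 / √ρ * (√ρ * √ρ) := by rw [hsρ]
      _ = √ρ := by field_simp
  set c : ℝ := τ * (2 * R / (2 + R)) with hcdef
  have hc0 : 0 < c := by positivity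
  have hc1 : c ≤ 1 := by
    have : 2 * R / (2 + R) ≤ 1 := by rw [div_le_one (by positivity)]; linarith
    calc c ≤ τ * 1 := by rw [hcdef]; gcongr
      _ ≤ 1 := by linarith
  refine ⟨4 * (5 + 4 / c), by positivity, ?_⟩
  set g : ℝ := (2 : ℝ) ^ R with hg
  have hg1 : 1 < g := Real.one_lt_rpow (by norm_num) hR0
  -- The factor n+1 is the union bound over i. The first term is the Chebyshev error, with 120000 =
  -- 2·60000 because 1/N ≤ 2g⁻ⁿ; the second is the Markov error for four-cycles.
  set δ : ℕ → ℝ := fun n => ((n : ℝ) + 1) *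
    (120000 / c ^ 2 * g⁻¹ ^ n + (1 / α) * (((n : ℝ) + 1) ^ 3 * √ρ ^ n)) with hδ
  have hδlim : Tendsto δ atTop (𝓝 0) := by
    have h1 := (tendsto_succ_pow_mul_pow 1 (r := g⁻¹) (by positivity)
      (inv_lt_one_of_one_lt₀ hg1)).const_mul (120000 / c ^ 2)
    have h2 := (tendsto_succ_pow_mul_pow 4 hsρ0 hsρ1).const_mul (1 / α)
    have h3 := h1.add h2
    rw [mul_zero, mul_zero, add_zero] at h3
    refine h3.congr fun n => ?_
    simp only [hδ]
    ring
  have hlow : Tendsto (fun n => 1 - ENNReal.ofReal (δ n)) atTop (𝓝 1) := by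
    have h1 := (ENNReal.continuous_ofReal.tendsto 0).comp hδlim
    rw [ENNReal.ofReal_zero] at h1
    have h2 := ENNReal.Tendsto.sub (tendsto_const_nhds (x := (1 : ENNReal)) (f := atTop)) h1
      (Or.inl ENNReal.one_ne_top)
    rwa [tsub_zero] at h2
  refine tendsto_of_tendsto_of_tendsto_of_le_of_le' hlow tendsto_const_nhds ?_
    (Eventually.of_forall fun n => ?_)
  swap
  · have := pointsLaw_isProbability n (prescribedCard R n)
    exact prob_le_one
  filter_upwards [hα τ hτ0, eventually_threshold_le hR0 hR1 τ hτ0,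
    eventually_add_le_prescribedCard hR0, eventually_ge_atTop 1] with n hαd hβd hN hn
  have hn' : (0 : ℝ) < n := by exact_mod_cast hn
  have hdpos : 1 ≤ threshold R τ n := by
    have : (0 : ℝ) < threshold R τ n := lt_of_lt_of_le (by positivity) hαd
    exact_mod_cast this
  have hμd := le_mul_sphereDensity_threshold (τ := τ) hR0 hβd hR1 hN
  have hq := (threshold_spec (R := R) (τ := τ) (n := n) (by omega)).trans hτ
  have hgn := le_two_mul_prescribedCard hR0.le n
  have hbounds : ∀ i : ℕ, threshold R τ n ≤ i → (i : ℝ) ≤ (1 + ε₀) * threshold R τ n →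
      _ := fun i hi hi' =>
    ratio_bounds hR0 hR1 hn hε₀R hα0 hαd hβd hi hi'
  have hmul : ∀ i : ℕ, threshold R τ n ≤ i → (i : ℝ) ≤ (1 + ε₀) * threshold R τ n →
      prescribedCard R n * sphereDensity n {i} ≤ 1 / α * ((1 / α) ^ ε₀) ^ n := by
    intro i hi hi'
    have hiβ := (hbounds i hi hi').1
    have hin : i ≤ n := by
      have : (i : ℝ) ≤ n := by nlinarith
      exact_mod_cast this
    refine (mul_sphereDensity_le hα0 (by linarith) hdpos hαd hi hin).trans ?_
    have hexp : ((i - threshold R τ n + 1 : ℕ) : ℝ) ≤ ε₀ * n + 1 := by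
      rw [Nat.cast_add, Nat.cast_sub hi]
      have : ε₀ * threshold R τ n ≤ ε₀ * n := by
        gcongr
        exact_mod_cast hi.trans hin
      push_cast
      linarith
    calc (1 / α) ^ (i - threshold R τ n + 1) =
          (1 / α) ^ ((i - threshold R τ n + 1 : ℕ) : ℝ) := (Real.rpow_natCast _ _).symm
      _ ≤ (1 / α) ^ (ε₀ * n + 1) := Real.rpow_le_rpow_of_exponent_le hA.le hexp
      _ = _ := by
        rw [Real.rpow_add (by positivity), Real.rpow_one, Real.rpow_mul_natCast (by positivity)]
        ring
  set N := prescribedCard R n with hNdef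
  set d₀ := threshold R τ n with hd₀
  have hNpos : (0 : ℝ) < N := by
    exact_mod_cast (by omega : 0 < N)
  have hc : ∀ i : ℕ, d₀ ≤ i → (i : ℝ) ≤ (1 + ε₀) * d₀ → c ≤ N * sphereDensity n {i} := by
    intro i hi hi'
    have hiβ := (hbounds i hi hi').1
    have h2i : 2 * i ≤ n := by
      have : 2 * (i : ℝ) ≤ n := by nlinarith
      exact_mod_cast this
    refine hμd.trans ?_
    have := sphereDensity_singleton_mono hi h2i
    gcongr
  have hdn : (1 + ε₀) * (d₀ : ℝ) ≤ n := by
    calc (1 + ε₀) * (d₀ : ℝ) ≤ (1 + R / 4) * ((1 / 2 - R / 4) * n) := by gcongr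
      _ = ((1 + R / 4) * (1 / 2 - R / 4)) * n := by ring
      _ ≤ 1 * n := mul_le_mul_of_nonneg_right (by nlinarith) hn'.le
      _ = n := one_mul _
  refine le_pointsLaw (card_not_spectrallyBounded_le hε₀.le hdpos hc0 hdn
    (B := 120000 / c ^ 2 * g⁻¹ ^ n + (1 / α) * (((n : ℝ) + 1) ^ 3 * √ρ ^ n)) (by positivity) hc
    fun i hi hi' => ?_)
  obtain ⟨hiβ, hyl, hyu⟩ := hbounds i hi hi'
  obtain ⟨t, ht, ht4, hle⟩ := hρ _ hyl hyu
  have hin : i < n := by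
    have : (i : ℝ) < n := by nlinarith
    exact_mod_cast this
  refine (card_not_typicalAt_le (by omega) (by omega) hin hc0 hc1 (hc i hi hi') hq ht hρ0 ht4
    hle).trans ?_
  refine mul_le_mul_of_nonneg_right (add_le_add ?_ ?_) (by positivity)
  · have hinv : 1 / (N : ℝ) ≤ 2 * g⁻¹ ^ n := by
      rw [inv_pow, div_le_iff₀ hNpos, mul_assoc, mul_comm (_)⁻¹, ← mul_assoc, ← div_eq_mul_inv,
        le_div_iff₀ (by positivity)]
      linarith
    calc 60000 / c ^ 2 / (N : ℝ) = 60000 / c ^ 2 * (1 / N) := by ring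
      _ ≤ 60000 / c ^ 2 * (2 * g⁻¹ ^ n) := by gcongr
      _ = _ := by ring
  · calc (N : ℝ) * sphereDensity n {i} * (ρ ^ n * ((n : ℝ) + 1) ^ 3) ≤
          1 / α * ((1 / α) ^ ε₀) ^ n * (ρ ^ n * ((n : ℝ) + 1) ^ 3) :=
          mul_le_mul_of_nonneg_right (hmul i hi hi') (by positivity)
      _ = 1 / α * (((n : ℝ) + 1) ^ 3 * ((1 / α) ^ ε₀ * ρ) ^ n) := by rw [mul_pow]; ring
      _ ≤ _ := by gcongr

end Main

end RandomCode

open RandomCode in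
theorem proposition1p9 (R : ℝ) (hR0 : 0 < R) (hR1 : R < 1) :
    ∃ ε₀ : ℝ, 0 < ε₀ ∧ ∃ τ₀ : ℝ, 0 < τ₀ ∧ ∀ τ : ℝ, 0 < τ → τ ≤ τ₀ →
      ∃ K : ℝ, 0 < K ∧
        Tendsto
          (fun n : ℕ => pointsLaw n (prescribedCard R n)
            {x | (code R τ n x).Nontrivial ∧
              ∀ i : ℕ, minDist (code R τ n x) ≤ i →
                (i : ℝ) ≤ (1 + ε₀) * (minDist (code R τ n x) : ℝ) →
                eigenvalueVector (code R τ n x) i ≠ 0 ∧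
                uniformNorm 4 (eigenvalueVector (code R τ n x) i) /
                  uniformNorm 2 (eigenvalueVector (code R τ n x) i) ≤ K})
          atTop (𝓝 1) := by
  obtain ⟨ε₀, hε₀, h⟩ := exists_tendsto_spectrallyBounded R hR0 hR1
  exact ⟨ε₀, hε₀, 1 / 16, by norm_num, h⟩
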